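/- **Setting.** Let $d\ge 1$, $T\ge 1$, $S^d=\{c\in\mathbb R^d:\|c\|=1\}$. Put $\theta(c,v)$ for the angle between $c$ and $v$, with $\theta(0,v)=0$. For $C\subseteq\mathbb R^d$ the uncertainty angle is $\alpha(C)=\inf_{v\in S^d}\sup_{c\in C}\theta(c,v)$, and a circumcenter of $C$ is a $v\in S^d$ attaining it. An initial knowledge set $C_0\subseteq S^d$ is given and an unknown cost vector $c^\star\in C_0$ is fixed. In each period $t=1,\dots,T$ an adversary picks a nonempty feasible set $\mathcal X_t\subset\mathbb R^m$ of diameter at most $1$ and a context function $f_t$ into $\mathbb R^d$ that is $1$-Lipschitz on $\mathcal X_t$. Let $\psi(c,\mathcal X,f)=\arg\min_{x\in\mathcal X}f(x)'c$ (assumed attained where it is used). The decision-maker plays $x_t\in\mathcal X_t$ and then observes some $x_t^\star\in\psi(c^\star,\mathcal X_t,f_t)$. The cumulative regret is $\sum_{t=1}^T(f_t(x_t)-f_t(x_t^\star))'c^\star$. **Algorithm EllipsoidalCones with parameter $\varepsilon$.** For a diagonal $W\in\mathbb R^{(d-1)\times(d-1)}$ with nonnegative entries and an orthogonal $U\in\mathbb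 R^{d\times d}$ let $E(W,U)=\{Uy: y_{1}\ge 0,\ y_{[2:d]}'W^{-1}y_{[2:d]}\le y_{1}^2\}$ (a zero entry of $W$ forces the corresponding coordinate of $y$ to be $0$). Start with $W_1=\tan^2\alpha(C_0)\,I$ and an orthogonal $U_1$ such that $U_1e_1$ is a circumcenter of $C_0$. In period $t$ let $c_t$ be the circumcenter of $E(W_t,U_t)$ and play $x_t\in\psi(c_t,\mathcal X_t,f_t)$. Let $\delta_t=(f_t(x_t)-f_t(x_t^\star))/\|f_t(x_t)-f_t(x_t^\star)\|$ ($\delta_t=0$ if the denominator vanishes), $\bar\delta=U_t^{-1}\delta_t$ and $q=\bar\delta_{[2:d]}'W_t\bar\delta_{[2:d]}$. If $q\le\varepsilon^2$, keep $(W_{t+1},U_{t+1})=(W_t,U_t)$. If $q>\varepsilon^2$, set $$b=\frac{W_t\bar\delta_{[2:d]}}{\sqrt q},\quad a=\frac bd,\quad N=\frac{(d-1)^2}{(d-1)^2-1}\Bigl(W_t-\frac2d\,bb'\Bigr),\quad M=\begin{pmatrix}1&a'\\a&aa'-N\end{pmatrix},$$ with $N=W_t/4$ if $d=2$. Take an orthogonal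 diagonalization $M=V\Lambda V'$ with eigenvalues in nonincreasing order and $V_{11}>0$; set $U_{t+1}=U_tV$ and let $W_{t+1}$ be the diagonal matrix of the eigenvalues of $N$ in nondecreasing order. **Theorem.** Suppose $\alpha(C_0)<\pi/2$. 1. For every $c^\star\in C_0$, every sequence of feasible sets and context functions as above, and all choices of minimizers and diagonalizations, every run of EllipsoidalCones with $\varepsilon=d/T$ has cumulative regret at most $$2(d-1)^2\max\{0,\ln(10\,T\tan\alpha(C_0))\}+d,$$ where the first summand is $0$ if $\alpha(C_0)=0$. 2. EllipsoidalCones with $\varepsilon=d/T$ runs in time polynomial in $d$ and $T$. Precisely, in a real-number model of computation where each real or index operation, comparison, memory access and loop iteration costs a bounded number of steps, an orthogonal diagonalization of a symmetric $k\times k$ matrix costs $\kappa k^3+1$ steps, and each period has one call of the optimization oracle (announce $c_t$, receive $f_t(x_t)$ and $f_t(x_t^\star)$) at a cost of $3d+1$ steps, there is a single program, independent of $d$ and $T$, that receives $d$, $T$, the circumcenter of $C_0$ and $\tan\alpha(C_0)$ and whose every execution is a run of the algorithm. For every constant $\kappa$ there is a polynomial $P$ such that the total number of steps is at most $P(d,T)$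 in every instance. -/

import Mathlib

open scoped Matrix

noncomputable section

namespace ConeRegret

/-- The Euclidean space `ℝᵈ` with `d = n + 1`. Coordinate `0` is the first coordinate, the
coordinates `i.succ` with `i : Fin n` are the remaining `d - 1` ones. -/
abbrev Vec (n : ℕ) := EuclideanSpace ℝ (Fin (n + 1))

/-! ### Angles, uncertainty angle, circumcenter -/

/-- Angle between `c` and `v`, with the convention that the angle is `0` when `c = 0`. -/
def theta {n : ℕ} (c v : Vec n) : ℝ :=
  open Classical in if c = 0 then 0 else InnerProductGeometry.angle c v

/-- Uncertainty angle `α(C)`: the infimum over unit vectors `v` of the largest angle between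
`v` and an element of `C`. -/
def uncertaintyAngle {n : ℕ} (C : Set (Vec n)) : ℝ :=
  ⨅ v : Metric.sphere (0 : Vec n) 1, ⨆ c : C, theta (c : Vec n) v

/-- `v` is a circumcenter of `C`: a unit vector attaining the uncertainty angle. -/
def IsCircumcenter {n : ℕ} (C : Set (Vec n)) (v : Vec n) : Prop :=
  ‖v‖ = 1 ∧ ⨆ c : C, theta (c : Vec n) v = uncertaintyAngle C

/-! ### Forward problems and regret -/

/-- `ψ(c, X, f)`: the minimizers of `x ↦ f(x)'c` over `X`. -/
def argmins {n m : ℕ} (c : Vec n) (X : Set (EuclideanSpace ℝ (Fin m)))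
    (f : EuclideanSpace ℝ (Fin m) → Vec n) : Set (EuclideanSpace ℝ (Fin m)) :=
  {x | x ∈ X ∧ ∀ y ∈ X, inner ℝ (f x) c ≤ inner ℝ (f y) c}

/-- A sequence of feasible sets of diameter at most one and of context functions that are
`1`-Lipschitz on them, for the periods `0, …, T - 1`. -/
def Admissible {n m : ℕ} (T : ℕ) (X : ℕ → Set (EuclideanSpace ℝ (Fin m)))
    (f : ℕ → EuclideanSpace ℝ (Fin m) → Vec n) : Prop :=
  ∀ t < T, (X t).Nonempty ∧ (∀ x ∈ X t, ∀ y ∈ X t, dist x y ≤ 1) ∧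
    LipschitzOnWith 1 (f t) (X t)

/-- Cumulative regret `∑ₜ (fₜ(xₜ) - fₜ(xₜ⋆))'c⋆`. -/
def regret {n m : ℕ} (T : ℕ) (cstar : Vec n) (f : ℕ → EuclideanSpace ℝ (Fin m) → Vec n)
    (x xstar : ℕ → EuclideanSpace ℝ (Fin m)) : ℝ :=
  ∑ t ∈ Finset.range T, inner ℝ (f t (x t) - f t (xstar t)) cstar

/-- The effective difference: `f(x) - f(x⋆)` normalized, and `0` if it vanishes. -/
def effectiveDiff {n m : ℕ} (f : EuclideanSpace ℝ (Fin m) → Vec n)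
    (x xstar : EuclideanSpace ℝ (Fin m)) : Vec n :=
  ‖f x - f xstar‖⁻¹ • (f x - f xstar)

/-! ### Ellipsoidal cones and their update -/

/-- Coordinates `U⁻¹ c` of `c` in the orthonormal basis given by the columns of `U`. -/
def coords {n : ℕ} (U : Matrix (Fin (n + 1)) (Fin (n + 1)) ℝ) (c : Vec n) : Fin (n + 1) → ℝ :=
  Uᵀ *ᵥ WithLp.ofLp c

/-- The ellipsoidal cone `E(W, U)` for `W = diagonal w`: the vectors `c = U y` with `y₁ ≥ 0` and
`y_[2:d]' W⁻¹ y_[2:d] ≤ y₁²`. A vanishing diagonal entry of `W` forces the corresponding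
coordinate of `y` to vanish. -/
def ellipsoidalCone {n : ℕ} (w : Fin n → ℝ) (U : Matrix (Fin (n + 1)) (Fin (n + 1)) ℝ) :
    Set (Vec n) :=
  {c | 0 ≤ coords U c 0 ∧ (∀ i, w i = 0 → coords U c i.succ = 0) ∧
    ∑ i, coords U c i.succ ^ 2 / w i ≤ coords U c 0 ^ 2}

/-- The squared width `δ̄_[2:d]' W δ̄_[2:d]`, where `δ̄ = U⁻¹ δ` and `W = diagonal w`. -/
def width {n : ℕ} (w : Fin n → ℝ) (U : Matrix (Fin (n + 1)) (Fin (n + 1)) ℝ) (δ : Vec n) : ℝ :=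
  (fun i : Fin n => coords U δ i.succ) ⬝ᵥ
    (Matrix.diagonal w *ᵥ fun i : Fin n => coords U δ i.succ)

/-- `A = V Λ V'` with `V` orthogonal and `Λ = diagonal l`; the columns of `V` are eigenvectors. -/
def IsSpectralDecomposition {ι : Type} [Fintype ι] [DecidableEq ι] (A : Matrix ι ι ℝ)
    (l : ι → ℝ) (V : Matrix ι ι ℝ) : Prop :=
  V ∈ Matrix.orthogonalGroup ι ℝ ∧ A = V * Matrix.diagonal l * Vᵀ

/-- `b = W δ̄_[2:d] / √(δ̄_[2:d]' W δ̄_[2:d])`. -/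
def updB {n : ℕ} (w : Fin n → ℝ) (U : Matrix (Fin (n + 1)) (Fin (n + 1)) ℝ) (δ : Vec n) :
    Fin n → ℝ :=
  (Real.sqrt (width w U δ))⁻¹ • (Matrix.diagonal w *ᵥ fun i : Fin n => coords U δ i.succ)

/-- `a = b / d`. -/
def updA {n : ℕ} (w : Fin n → ℝ) (U : Matrix (Fin (n + 1)) (Fin (n + 1)) ℝ) (δ : Vec n) :
    Fin n → ℝ :=
  ((n : ℝ) + 1)⁻¹ • updB w U δ

/-- `N = (d-1)² / ((d-1)² - 1) (W - (2/d) b b')`. For `d = 2` this reads `(1/0) * 0`; there it is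
replaced by `W / 4`, the smallest one-dimensional ellipsoid (interval) containing
half of the given one. -/
def updN {n : ℕ} (w : Fin n → ℝ) (U : Matrix (Fin (n + 1)) (Fin (n + 1)) ℝ) (δ : Vec n) :
    Matrix (Fin n) (Fin n) ℝ :=
  if n = 1 then (1 / 4 : ℝ) • Matrix.diagonal w
  else ((n : ℝ) ^ 2 / ((n : ℝ) ^ 2 - 1)) •
    (Matrix.diagonal w - (2 / ((n : ℝ) + 1)) • Matrix.vecMulVec (updB w U δ) (updB w U δ))

/-- The block matrix `M` with rows `(1, a')` and `(a, a a' - N)`. -/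
def updM {n : ℕ} (w : Fin n → ℝ) (U : Matrix (Fin (n + 1)) (Fin (n + 1)) ℝ) (δ : Vec n) :
    Matrix (Fin (n + 1)) (Fin (n + 1)) ℝ :=
  Matrix.of <| Fin.cases
    (Fin.cases 1 fun j => updA w U δ j)
    (fun i => Fin.cases (updA w U δ i)
      fun j => updA w U δ i * updA w U δ j - updN w U δ i j)

/-- `(w', U')` is an output of the cone update on `(w, U)` with the cut `δ`: `U' = U V` for a
spectral decomposition `M = V Λ V'` with the eigenvalues in nonincreasing order and the first
column of `V` oriented so that its first entry is positive, and `w'` lists the eigenvalues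
of `N` in nondecreasing order. -/
def ConeUpdate {n : ℕ} (w : Fin n → ℝ) (U : Matrix (Fin (n + 1)) (Fin (n + 1)) ℝ) (δ : Vec n)
    (w' : Fin n → ℝ) (U' : Matrix (Fin (n + 1)) (Fin (n + 1)) ℝ) : Prop :=
  (Monotone w' ∧ ∃ Q, IsSpectralDecomposition (updN w U δ) w' Q) ∧
  ∃ (l : Fin (n + 1) → ℝ) (V : Matrix (Fin (n + 1)) (Fin (n + 1)) ℝ),
    Antitone l ∧ IsSpectralDecomposition (updM w U δ) l V ∧ 0 < V 0 0 ∧ U' = U * V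

/-- The sequences `c` (proxy costs), `x` (actions), `w`, `U` (cones) form a run of the algorithm
`EllipsoidalCones` with parameter `ε` and initial knowledge set `C₀` over periods `0, …, T - 1`,
when the feasible sets, context functions and observed optimal actions are `X`, `f`, `xstar`. -/
structure IsRun {n m : ℕ} (ε : ℝ) (C₀ : Set (Vec n)) (T : ℕ)
    (X : ℕ → Set (EuclideanSpace ℝ (Fin m))) (f : ℕ → EuclideanSpace ℝ (Fin m) → Vec n)
    (xstar x : ℕ → EuclideanSpace ℝ (Fin m)) (c : ℕ → Vec n) (w : ℕ → Fin n → ℝ)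
    (U : ℕ → Matrix (Fin (n + 1)) (Fin (n + 1)) ℝ) : Prop where
  start_orthogonal : U 0 ∈ Matrix.orthogonalGroup (Fin (n + 1)) ℝ
  start_axis : IsCircumcenter C₀ (WithLp.toLp 2 fun i => U 0 i 0)
  start_width : ∀ i, w 0 i = Real.tan (uncertaintyAngle C₀) ^ 2
  proxy : ∀ t < T, IsCircumcenter (ellipsoidalCone (w t) (U t)) (c t)
  action : ∀ t < T, x t ∈ argmins (c t) (X t) (f t)
  cone_update : ∀ t < T, ε ^ 2 < width (w t) (U t) (effectiveDiff (f t) (x t) (xstar t)) →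
    ConeUpdate (w t) (U t) (effectiveDiff (f t) (x t) (xstar t)) (w (t + 1)) (U (t + 1))
  no_update : ∀ t < T, width (w t) (U t) (effectiveDiff (f t) (x t) (xstar t)) ≤ ε ^ 2 →
    w (t + 1) = w t ∧ U (t + 1) = U t

/-! ### A uniform programming language over the reals, with a step count

Memory consists of two-dimensional real arrays, numbered by `ℕ`, and of natural-number index
variables, numbered by `ℕ`. Every arithmetic operation, comparison, memory access and loop
iteration is counted. -/

/-- Index expressions. -/
inductive IExpr where
  | lit (k : ℕ)
  | var (v : ℕ)
  | plus (i j : IExpr)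
  | minus (i j : IExpr)

/-- Value of an index expression (subtraction is truncated). -/
def IExpr.eval (ix : ℕ → ℕ) : IExpr → ℕ
  | .lit k => k
  | .var v => ix v
  | .plus i j => i.eval ix + j.eval ix
  | .minus i j => i.eval ix - j.eval ix

/-- Number of steps to evaluate an index expression. -/
def IExpr.steps : IExpr → ℕ
  | .lit _ => 1
  | .var _ => 1
  | .plus i j => i.steps + j.steps + 1
  | .minus i j => i.steps + j.steps + 1

/-- Real expressions: array access, indices as reals, arithmetic, square roots, a sum of `e` over
`v = 0, …, k - 1`, and `if p ≤ q then r else s`. -/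
inductive RExpr where
  | get (a : ℕ) (i j : IExpr)
  | cast (i : IExpr)
  | plus (p q : RExpr)
  | minus (p q : RExpr)
  | times (p q : RExpr)
  | over (p q : RExpr)
  | root (p : RExpr)
  | sum (v : ℕ) (k : IExpr) (e : RExpr)
  | cond (p q r s : RExpr)

/-- Value of a real expression. -/
def RExpr.eval (mem : ℕ → ℕ → ℕ → ℝ) : (ℕ → ℕ) → RExpr → ℝ
  | ix, .get a i j => mem a (i.eval ix) (j.eval ix)
  | ix, .cast i => (i.eval ix : ℝ)
  | ix, .plus p q => p.eval mem ix + q.eval mem ix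
  | ix, .minus p q => p.eval mem ix - q.eval mem ix
  | ix, .times p q => p.eval mem ix * q.eval mem ix
  | ix, .over p q => p.eval mem ix / q.eval mem ix
  | ix, .root p => Real.sqrt (p.eval mem ix)
  | ix, .sum v k e => ∑ r ∈ Finset.range (k.eval ix), e.eval mem (Function.update ix v r)
  | ix, .cond p q r s => if p.eval mem ix ≤ q.eval mem ix then r.eval mem ix else s.eval mem ix

/-- Number of steps to evaluate a real expression. -/
def RExpr.steps (mem : ℕ → ℕ → ℕ → ℝ) : (ℕ → ℕ) → RExpr → ℕ
  | _, .get _ i j => i.steps + j.steps + 1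
  | _, .cast i => i.steps + 1
  | ix, .plus p q => p.steps mem ix + q.steps mem ix + 1
  | ix, .minus p q => p.steps mem ix + q.steps mem ix + 1
  | ix, .times p q => p.steps mem ix + q.steps mem ix + 1
  | ix, .over p q => p.steps mem ix + q.steps mem ix + 1
  | ix, .root p => p.steps mem ix + 1
  | ix, .sum v k e => k.steps + 1 +
      ∑ r ∈ Finset.range (k.eval ix), (e.steps mem (Function.update ix v r) + 2)
  | ix, .cond p q r s => p.steps mem ix + q.steps mem ix + 1 +
      if p.eval mem ix ≤ q.eval mem ix then r.steps mem ix else s.steps mem ix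

/-- Commands: no operation; `a[u][v] := e` for all `u < k`, `v < l` (all right-hand sides are
evaluated before any entry is written); sequencing; branching on `p ≤ q`; a loop over
`v = 0, …, k - 1`; and the spectral decomposition of the `k × k` block of array `a`, which
writes the eigenvalues to column `0` of array `l` and the eigenvectors to the columns of
array `q`. -/
inductive Cmd where
  | skip
  | fill (a u v : ℕ) (k l : IExpr) (e : RExpr)
  | seq (p q : Cmd)
  | cond (p q : RExpr) (r s : Cmd)
  | loop (v : ℕ) (k : IExpr) (p : Cmd)
  | eig (a : ℕ) (k : IExpr) (l q : ℕ)

/-- A state of the machine, together with the number of steps made so far. -/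
structure State where
  mem : ℕ → ℕ → ℕ → ℝ
  ix : ℕ → ℕ
  steps : ℕ

/-- Overwrite the `k × l` block of array `a` with the values `g`. -/
def setBlock (mem : ℕ → ℕ → ℕ → ℝ) (a k l : ℕ) (g : ℕ → ℕ → ℝ) : ℕ → ℕ → ℕ → ℝ :=
  Function.update mem a fun i j => if i < k ∧ j < l then g i j else mem a i j

/-- A spectral decomposition routine: eigenvalues and eigenvector matrix for each size. -/
abbrev Solver := (k : ℕ) → Matrix (Fin k) (Fin k) ℝ → (Fin k → ℝ) × Matrix (Fin k) (Fin k) ℝ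

/-- On symmetric matrices, the routine returns a spectral decomposition with the eigenvalues in
nonincreasing order. -/
def Solver.Correct (S : Solver) : Prop :=
  ∀ (k : ℕ) (A : Matrix (Fin k) (Fin k) ℝ), A.IsSymm →
    Antitone (S k A).1 ∧ IsSpectralDecomposition A (S k A).1 (S k A).2

/-- Execution of a command. A spectral decomposition of size `k` is charged `κ k³ + 1` steps on
top of the evaluation of `k`; all other costs are unit costs. -/
def Cmd.exec (S : Solver) (κ : ℕ) : Cmd → State → State
  | .skip, s => s
  | .fill a u v k l e, s =>
      { mem := setBlock s.mem a (k.eval s.ix) (l.eval s.ix) fun i j =>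
          e.eval s.mem (Function.update (Function.update s.ix u i) v j)
        ix := s.ix
        steps := s.steps + k.steps + l.steps + 1 +
          ∑ i ∈ Finset.range (k.eval s.ix), (1 + ∑ j ∈ Finset.range (l.eval s.ix),
            (e.steps s.mem (Function.update (Function.update s.ix u i) v j) + 2)) }
  | .seq p q, s => q.exec S κ (p.exec S κ s)
  | .cond p q r t, s =>
      let s' : State :=
        { mem := s.mem, ix := s.ix
          steps := s.steps + p.steps s.mem s.ix + q.steps s.mem s.ix + 1 }
      if p.eval s.mem s.ix ≤ q.eval s.mem s.ix then r.exec S κ s' else t.exec S κ s'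
  | .loop v k p, s =>
      (List.range (k.eval s.ix)).foldl
        (fun s' r => p.exec S κ
          { mem := s'.mem, ix := Function.update s'.ix v r, steps := s'.steps + 1 })
        { mem := s.mem, ix := s.ix, steps := s.steps + k.steps + 1 }
  | .eig a k l q, s =>
      let N := k.eval s.ix
      let D := S N (Matrix.of fun i j => s.mem a i j)
      { mem := setBlock
          (setBlock s.mem l N 1 fun i _ => if h : i < N then D.1 ⟨i, h⟩ else 0) q N N
          fun i j => if h : i < N ∧ j < N then D.2 ⟨i, h.1⟩ ⟨j, h.2⟩ else 0
        ix := s.ix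
        steps := s.steps + k.steps + κ * N ^ 3 + 1 }

/-- An online program: one command run before the first period, and one run at the end of every
period. Neither depends on the dimension, the horizon or any real constant. -/
structure OnlineProgram where
  start : Cmd
  step : Cmd

/-- The state before the program starts: index variables `0` and `1` hold `d = n + 1` and `T`, the
vector `c₀` is in array `0`, the number `τ` is in array `1`, and everything else is zero. -/
def inputState (n T : ℕ) (c₀ : Vec n) (τ : ℝ) : State where
  mem := fun a i j =>
    if a = 0 ∧ j = 0 then (if h : i < n + 1 then c₀ ⟨i, h⟩ else 0)
    else if a = 1 ∧ i = 0 ∧ j = 0 then τ else 0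
  ix := fun v => if v = 0 then n + 1 else if v = 1 then T else 0
  steps := 0

/-- The proxy cost vector announced by the program, read off array `2`. -/
def State.proxy (n : ℕ) (s : State) : Vec n :=
  WithLp.toLp 2 fun i => s.mem 2 i 0

/-- Write the vectors `g` and `h` into arrays `3` and `4`. The announcement of the proxy cost,
the call of the optimization oracle and the transfer of the answers cost `3 d + 1` steps. -/
def State.receive {n : ℕ} (s : State) (g h : Vec n) : State where
  mem := setBlock
    (setBlock s.mem 3 (n + 1) 1 fun i _ => if hi : i < n + 1 then g ⟨i, hi⟩ else 0) 4 (n + 1) 1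
    fun i _ => if hi : i < n + 1 then h ⟨i, hi⟩ else 0
  ix := s.ix
  steps := s.steps + 3 * (n + 1) + 1

/-- The state of the online program after `t` periods, when the vectors received in period `r`
are `g r` and `h r`. -/
def OnlineProgram.run (p : OnlineProgram) (S : Solver) (κ : ℕ) {n : ℕ} (T : ℕ) (c₀ : Vec n)
    (τ : ℝ) (g h : ℕ → Vec n) : ℕ → State
  | 0 => p.start.exec S κ (inputState n T c₀ τ)
  | t + 1 => p.step.exec S κ ((p.run S κ T c₀ τ g h t).receive (g t) (h t))

end ConeRegret

end

noncomputable section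

namespace ConeRegret

/-! ### Spectral decompositions -/

section Spectral

variable {ι : Type} [Fintype ι] [DecidableEq ι] {A V : Matrix ι ι ℝ} {l : ι → ℝ}

/-! Write `n = d - 1` and `τ = tan α(C₀)`. The circumcenter of an ellipsoidal cone is its axis, and
it is the only one (`isCircumcenter_ellipsoidalCone`), so each period plays an optimum for the axis.
If the cone contains `c⋆`, optimality of `x_t` and of `x_t⋆` gives `δ'U e₁ ≤ 0 ≤ δ'c⋆`. The axis
part of `δ'c⋆` is then nonpositive, and Cauchy-Schwarz in the norm of `W` bounds the regret of the
period by `√q`, besides the trivial bound `1` (`period_bounds`). Periods without update cost at most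
`T ε = d` altogether, so it remains to count the updates.

An update cuts every slice of the cone through its center. The half slice at height `y` lies in the
ellipsoid with center `y a` and matrix `y² N` (`exists_cutMatrix_mulVec_eq`). These ellipsoids form
a tilted quadratic cone, whose dual is given by the form `M`. In an eigenbasis of `M` the tilted
cone is `∑ y_i² / |l_i| ≤ y₁² / l_1`, with `l_1 ≥ 1` and, by interlacing, `|l_i|` at most the
matching eigenvalue of `N`. Hence the new ellipsoidal cone contains it
(`eigencoordinates_mem_cone`), and `c⋆` is never lost.

The potential is `∏ w_i`. It starts at `τ^(2n)`, and an update multiplies it by at most `exp (-1/n)`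
(`det_cutMatrix_le`). In the other direction, a lower bound `μ` on all `w_i` survives an update
whenever `4 n² μ ≤ q` (`le_dotProduct_cutMatrix`): only directions much wider than `μ` are cut.
Since updates have `q > (d/T)²`, the value `μ = (10 T)⁻²` is admissible if `τ > ε`, while for `τ ≤
ε` no update ever happens. Comparing `μ^n ≤ exp (-I/n) τ^(2n)` yields `I ≤ 2 n² ln(10 T τ)` for the
number `I` of updates.

For the running time, an explicit loop-free program is shown to perform the updates (`step_spec`).
All its block sizes and sums are bounded by `d`, so a polynomial bound on its steps can be read off
its syntax (`OnlineProgram.run_steps_le`). -/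

lemma transpose_mul_self_of_orthogonal (hV : V ∈ Matrix.orthogonalGroup ι ℝ) : Vᵀ * V = 1 :=
  (Matrix.mem_orthogonalGroup_iff' ι ℝ).1 hV

lemma self_mul_transpose_of_orthogonal (hV : V ∈ Matrix.orthogonalGroup ι ℝ) : V * Vᵀ = 1 :=
  (Matrix.mem_orthogonalGroup_iff ι ℝ).1 hV

lemma dotProduct_transpose_mulVec (hV : V ∈ Matrix.orthogonalGroup ι ℝ) (u v : ι → ℝ) :
    (Vᵀ *ᵥ u) ⬝ᵥ (Vᵀ *ᵥ v) = u ⬝ᵥ v := by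
  rw [Matrix.dotProduct_mulVec, Matrix.vecMul_transpose, Matrix.mulVec_mulVec,
    self_mul_transpose_of_orthogonal hV, Matrix.one_mulVec]

lemma transpose_mulVec_mulVec (hV : V ∈ Matrix.orthogonalGroup ι ℝ) (u : ι → ℝ) :
    Vᵀ *ᵥ (V *ᵥ u) = u := by
  rw [Matrix.mulVec_mulVec, transpose_mul_self_of_orthogonal hV, Matrix.one_mulVec]

lemma IsSpectralDecomposition.transpose_mulVec (h : IsSpectralDecomposition A l V) (u : ι → ℝ)
    (i : ι) : (Vᵀ *ᵥ (A *ᵥ u)) i = l i * (Vᵀ *ᵥ u) i := by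
  rw [h.2, ← Matrix.mulVec_mulVec, ← Matrix.mulVec_mulVec, transpose_mulVec_mulVec h.1,
    Matrix.mulVec_diagonal]

lemma IsSpectralDecomposition.dotProduct_mulVec (h : IsSpectralDecomposition A l V)
    (u v : ι → ℝ) : u ⬝ᵥ A *ᵥ v = ∑ i, l i * ((Vᵀ *ᵥ u) i * (Vᵀ *ᵥ v) i) := by
  rw [← dotProduct_transpose_mulVec h.1]
  simp only [dotProduct, h.transpose_mulVec]
  exact Finset.sum_congr rfl fun i _ => by ring

lemma IsSpectralDecomposition.form_mulVec (h : IsSpectralDecomposition A l V) (x : ι → ℝ) :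
    (V *ᵥ x) ⬝ᵥ A *ᵥ (V *ᵥ x) = ∑ i, l i * x i ^ 2 := by
  rw [h.dotProduct_mulVec, transpose_mulVec_mulVec h.1]
  exact Finset.sum_congr rfl fun i _ => by ring

lemma IsSpectralDecomposition.form_col (h : IsSpectralDecomposition A l V) (k : ι) :
    (V.col k) ⬝ᵥ A *ᵥ (V.col k) = l k := by
  have := h.form_mulVec (Pi.single k 1)
  rw [Matrix.mulVec_single_one] at this
  rw [this, Finset.sum_eq_single k] <;> simp +contextual

lemma dotProduct_col_self (hV : V ∈ Matrix.orthogonalGroup ι ℝ) (k : ι) :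
    V.col k ⬝ᵥ V.col k = 1 := by
  have := congrFun (congrFun (transpose_mul_self_of_orthogonal hV) k) k
  simpa [Matrix.mul_apply, dotProduct] using this

lemma IsSpectralDecomposition.mulVec_col (h : IsSpectralDecomposition A l V) (k : ι) :
    A *ᵥ V.col k = l k • V.col k := by
  rw [← Matrix.mulVec_single_one, h.2, ← Matrix.mulVec_mulVec, transpose_mulVec_mulVec h.1,
    ← Matrix.mulVec_mulVec, Matrix.diagonal_mulVec_single, mul_one,
    ← Matrix.mulVec_smul]
  congr 1
  ext i
  simp [Pi.single_apply]

lemma IsSpectralDecomposition.neg (h : IsSpectralDecomposition A l V) :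
    IsSpectralDecomposition A l (-V) := by
  refine ⟨?_, by rw [h.2]; simp⟩
  rw [Matrix.mem_orthogonalGroup_iff]
  simpa using self_mul_transpose_of_orthogonal h.1

lemma IsSpectralDecomposition.sq_dotProduct_mulVec_le (h : IsSpectralDecomposition A l V)
    (hl : ∀ i, 0 ≤ l i) (u v : ι → ℝ) :
    (u ⬝ᵥ A *ᵥ v) ^ 2 ≤ (u ⬝ᵥ A *ᵥ u) * (v ⬝ᵥ A *ᵥ v) := by
  simp only [h.dotProduct_mulVec]
  refine Finset.sum_sq_le_sum_mul_sum_of_sq_le_mul _ (fun i _ => ?_) (fun i _ => ?_) fun i _ => ?_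
  · exact mul_nonneg (hl i) (mul_self_nonneg _)
  · exact mul_nonneg (hl i) (mul_self_nonneg _)
  · exact le_of_eq (by ring)

end Spectral

/-! ### The block matrix `M` -/

/-- The block matrix with rows `(1, a')` and `(a, a a' - N)`. -/
def blockMatrix {n : ℕ} (a : Fin n → ℝ) (N : Matrix (Fin n) (Fin n) ℝ) :
    Matrix (Fin (n + 1)) (Fin (n + 1)) ℝ :=
  Matrix.of <| Fin.cases (Fin.cases 1 fun j => a j)
    (fun i => Fin.cases (a i) fun j => a i * a j - N i j)

lemma updM_eq_blockMatrix {n : ℕ} (w : Fin n → ℝ) (U : Matrix (Fin (n + 1)) (Fin (n + 1)) ℝ)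
    (δ : Vec n) : updM w U δ = blockMatrix (updA w U δ) (updN w U δ) := rfl

section Block

variable {n : ℕ} {a : Fin n → ℝ} {N : Matrix (Fin n) (Fin n) ℝ}

lemma blockMatrix_mulVec_zero (u : Fin (n + 1) → ℝ) :
    (blockMatrix a N *ᵥ u) 0 = u 0 + a ⬝ᵥ Fin.tail u := by
  simp [blockMatrix, Matrix.mulVec, dotProduct, Fin.sum_univ_succ, Fin.tail]

lemma blockMatrix_mulVec_succ (u : Fin (n + 1) → ℝ) (i : Fin n) :
    (blockMatrix a N *ᵥ u) i.succ =
      a i * (u 0 + a ⬝ᵥ Fin.tail u) - (N *ᵥ Fin.tail u) i := by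
  simp only [blockMatrix, Matrix.mulVec, dotProduct, Fin.sum_univ_succ, Fin.tail, Matrix.of_apply,
    Fin.cases_zero, Fin.cases_succ, sub_mul, Finset.sum_sub_distrib, mul_add, Finset.mul_sum]
  rw [add_sub_assoc]
  congr 2
  exact Finset.sum_congr rfl fun _ _ => by ring

/-- Completing the square. With `u 0 + a'ũ ≥ 0`, nonnegativity of this form describes the dual of
the cone whose slice at height `y` is the ellipsoid with center `y a` and matrix `y² N`. The
difference of a square and a semidefinite form also shows that at most one eigenvalue can be
positive. -/
lemma dotProduct_blockMatrix_mulVec (u : Fin (n + 1) → ℝ) :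
    u ⬝ᵥ blockMatrix a N *ᵥ u =
      (u 0 + a ⬝ᵥ Fin.tail u) ^ 2 - Fin.tail u ⬝ᵥ N *ᵥ Fin.tail u := by
  have h1 : u ⬝ᵥ blockMatrix a N *ᵥ u = u 0 * (blockMatrix a N *ᵥ u) 0 +
      ∑ i, Fin.tail u i * (blockMatrix a N *ᵥ u) i.succ := by
    rw [dotProduct, Fin.sum_univ_succ]; rfl
  have h2 : ∑ i, Fin.tail u i * (a i * (u 0 + a ⬝ᵥ Fin.tail u)) =
      (a ⬝ᵥ Fin.tail u) * (u 0 + a ⬝ᵥ Fin.tail u) := by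
    rw [dotProduct, Finset.sum_mul]
    exact Finset.sum_congr rfl fun _ _ => by ring
  rw [h1, blockMatrix_mulVec_zero]
  simp only [blockMatrix_mulVec_succ, mul_sub, Finset.sum_sub_distrib, h2]
  rw [← dotProduct]
  ring

variable {l : Fin (n + 1) → ℝ} {V : Matrix (Fin (n + 1)) (Fin (n + 1)) ℝ}

/-- The largest eigenvalue dominates the Rayleigh quotient at the first unit vector, which is the
corner entry `1`. -/
lemma one_le_eigenvalue_zero (hM : IsSpectralDecomposition (blockMatrix a N) l V)
    (hl : Antitone l) : 1 ≤ l 0 := by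
  have h1 := hM.dotProduct_mulVec (Pi.single 0 1) (Pi.single 0 1)
  have h2 := dotProduct_transpose_mulVec hM.1 (Pi.single 0 1) (Pi.single 0 1)
  rw [dotProduct_blockMatrix_mulVec] at h1
  have h3 : Fin.tail (Pi.single 0 1 : Fin (n + 1) → ℝ) = 0 := by
    ext i; simp [Fin.tail]
  rw [h3] at h1
  simp only [Pi.single_eq_same, dotProduct_zero, add_zero, one_pow, Matrix.mulVec_zero,
    sub_zero] at h1
  simp only [dotProduct_single, Pi.single_eq_same, mul_one] at h2
  have h4 : l 0 = l 0 * ((Vᵀ *ᵥ Pi.single 0 1) ⬝ᵥ (Vᵀ *ᵥ Pi.single 0 1)) := by rw [h2, mul_one]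
  rw [h1, h4, dotProduct, Finset.mul_sum]
  exact Finset.sum_le_sum fun i _ =>
    mul_le_mul_of_nonneg_right (hl (Fin.zero_le i)) (mul_self_nonneg _)

/-- If the entry vanished, the first row of the eigenvector equation would kill the square in the
form, leaving a nonpositive value where the eigenvalue is at least `1`. This makes the normalization
`V₁₁ > 0` attainable by a change of sign. -/
lemma eigenvector_zero_ne_zero (hM : IsSpectralDecomposition (blockMatrix a N) l V)
    (hl : Antitone l) (hN : ∀ v, 0 ≤ v ⬝ᵥ N *ᵥ v) : V 0 0 ≠ 0 := by
  intro h0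
  have h1 := hM.form_col 0
  have h2 := congrFun (hM.mulVec_col 0) 0
  rw [dotProduct_blockMatrix_mulVec] at h1
  rw [blockMatrix_mulVec_zero] at h2
  simp only [Pi.smul_apply, smul_eq_mul, Matrix.col_apply, h0, mul_zero, zero_add] at h1 h2
  rw [h2] at h1
  linarith [hN (Fin.tail (V.col 0)), one_le_eigenvalue_zero hM hl]

lemma eigenvalue_succ_nonpos (hM : IsSpectralDecomposition (blockMatrix a N) l V)
    (hl : Antitone l) (hN : ∀ v, 0 ≤ v ⬝ᵥ N *ᵥ v) (i : Fin n) : l i.succ ≤ 0 := by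
  by_contra! hpos
  have h1 := one_le_eigenvalue_zero hM hl
  have hV := eigenvector_zero_ne_zero hM hl hN
  -- In the plane of two eigenvectors with positive eigenvalues, this combination makes the first
  -- entry of `M V x` vanish. The square in the form then disappears and the form is nonpositive,
  -- against positivity on the plane.
  set x : Fin (n + 1) → ℝ :=
    Pi.single 0 (-(V 0 i.succ * l i.succ)) + Pi.single i.succ (V 0 0 * l 0) with hx
  have hx0 : x 0 = -(V 0 i.succ * l i.succ) := by
    simp [hx, (Fin.succ_ne_zero i).symm]
  have hxi : x i.succ = V 0 0 * l 0 := by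
    simp [hx]
  have hform := hM.form_mulVec x
  have hz : (blockMatrix a N *ᵥ (V *ᵥ x)) 0 = 0 := by
    rw [hx, Matrix.mulVec_add, Matrix.mulVec_add]
    have key : ∀ (k : Fin (n + 1)) (r : ℝ),
        (blockMatrix a N *ᵥ (V *ᵥ Pi.single k r)) 0 = r * (l k * V 0 k) := by
      intro k r
      have : (Pi.single k r : Fin (n + 1) → ℝ) = r • Pi.single k 1 := by
        ext j; simp [Pi.single_apply]
      rw [this, Matrix.mulVec_smul, Matrix.mulVec_smul, Matrix.mulVec_single_one, hM.mulVec_col]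
      simp
    rw [Pi.add_apply, key, key]
    ring
  rw [dotProduct_blockMatrix_mulVec, ← blockMatrix_mulVec_zero (N := N), hz] at hform
  have hpos' : 0 < ∑ k, l k * x k ^ 2 := by
    have hnn : ∀ k ∈ Finset.univ, 0 ≤ l k * x k ^ 2 := by
      intro k _
      by_cases hk : k = 0
      · subst hk; positivity
      by_cases hk' : k = i.succ
      · subst hk'; positivity
      · simp [hx, hk, hk']
    refine lt_of_lt_of_le ?_ (Finset.single_le_sum hnn (Finset.mem_univ i.succ))
    rw [hxi]
    have : V 0 0 * l 0 ≠ 0 := mul_ne_zero hV (by linarith)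
    positivity
  linarith [hN (Fin.tail (V *ᵥ x))]

lemma IsSpectralDecomposition.nonneg {m : ℕ} {A Q : Matrix (Fin m) (Fin m) ℝ} {μ : Fin m → ℝ}
    (h : IsSpectralDecomposition A μ Q) (hA : ∀ v, 0 ≤ v ⬝ᵥ A *ᵥ v) (i : Fin m) : 0 ≤ μ i := by
  rw [← h.form_col i]; exact hA _

/-- Interlacing by a Courant-Fischer argument: on a suitable vector, `M` is at most `l i.succ`
because of its own eigenvectors, and at least `-μ i` because `M` exceeds `-N` on the tail by a
square. -/
lemma neg_le_eigenvalue_succ (hM : IsSpectralDecomposition (blockMatrix a N) l V)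
    (hl : Antitone l) (hN : ∀ v, 0 ≤ v ⬝ᵥ N *ᵥ v) {μ : Fin n → ℝ} {Q : Matrix (Fin n) (Fin n) ℝ}
    (hQ : IsSpectralDecomposition N μ Q) (hμ : Monotone μ) (i : Fin n) : -μ i ≤ l i.succ := by
  -- The conditions `j ≤ i` remove the first `i + 1` eigenvectors of `M` from `u`. The others remove
  -- from the tail the eigenvectors of `N` beyond `i`. These are `n` equations in `n + 1` unknowns,
  -- so a nonzero solution exists.
  let L : (Fin (n + 1) → ℝ) →ₗ[ℝ] (Fin n → ℝ) :=
    LinearMap.pi fun j => if j ≤ i then (LinearMap.proj j.castSucc).comp (Matrix.mulVecLin Vᵀ)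
      else (LinearMap.proj j).comp ((Matrix.mulVecLin Qᵀ).comp (LinearMap.funLeft ℝ ℝ Fin.succ))
  have hker : L.ker ≠ ⊥ := LinearMap.ker_ne_bot_of_finrank_lt (by simp)
  obtain ⟨u, hu, hu0⟩ := (Submodule.ne_bot_iff _).1 hker
  have hLu : ∀ j, L u j = 0 := fun j => by rw [LinearMap.mem_ker.1 hu]; rfl
  have h1 : ∀ j ≤ i, (Vᵀ *ᵥ u) j.castSucc = 0 := by
    intro j hj
    have := hLu j
    simp only [L, LinearMap.pi_apply, if_pos hj] at this
    exact this
  have h2 : ∀ j, i < j → (Qᵀ *ᵥ Fin.tail u) j = 0 := by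
    intro j hj
    have := hLu j
    simp only [L, LinearMap.pi_apply, if_neg (not_le.2 hj)] at this
    exact this
  have hupos : 0 < u ⬝ᵥ u := by
    have h := dotProduct_self_star_nonneg u
    simp only [star_trivial] at h
    exact lt_of_le_of_ne h fun h => hu0 (dotProduct_self_eq_zero.1 h.symm)
  have hA : u ⬝ᵥ blockMatrix a N *ᵥ u ≤ l i.succ * (u ⬝ᵥ u) := by
    rw [hM.dotProduct_mulVec, ← dotProduct_transpose_mulVec hM.1 u u, dotProduct, Finset.mul_sum]
    refine Finset.sum_le_sum fun k _ => ?_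
    by_cases hk : k ≤ i.castSucc
    · obtain ⟨j, rfl⟩ : ∃ j : Fin n, j.castSucc = k :=
        ⟨k.castPred (ne_of_lt (lt_of_le_of_lt hk (Fin.castSucc_lt_last i))), by simp⟩
      rw [h1 j (by simpa using hk)]
      simp
    · refine mul_le_mul_of_nonneg_right (hl ?_) (mul_self_nonneg _)
      exact Fin.castSucc_lt_iff_succ_le.1 (not_le.1 hk)
  have hB : Fin.tail u ⬝ᵥ N *ᵥ Fin.tail u ≤ μ i * (u ⬝ᵥ u) := by
    have hμi : 0 ≤ μ i := hQ.nonneg hN i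
    calc Fin.tail u ⬝ᵥ N *ᵥ Fin.tail u ≤ μ i * (Fin.tail u ⬝ᵥ Fin.tail u) := by
          rw [hQ.dotProduct_mulVec, ← dotProduct_transpose_mulVec hQ.1 (Fin.tail u), dotProduct,
            Finset.mul_sum]
          refine Finset.sum_le_sum fun k _ => ?_
          by_cases hk : k ≤ i
          · exact mul_le_mul_of_nonneg_right (hμ hk) (mul_self_nonneg _)
          · rw [h2 k (not_le.1 hk)]; simp
      _ ≤ μ i * (u ⬝ᵥ u) := by
          refine mul_le_mul_of_nonneg_left ?_ hμi
          rw [dotProduct, dotProduct, Fin.sum_univ_succ]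
          simp only [Fin.tail]
          linarith [mul_self_nonneg (u 0)]
  rw [dotProduct_blockMatrix_mulVec] at hA
  have : 0 ≤ (l i.succ + μ i) * (u ⬝ᵥ u) := by
    nlinarith [sq_nonneg (u 0 + a ⬝ᵥ Fin.tail u)]
  have := nonneg_of_mul_nonneg_left this hupos
  linarith

/-- Vectors `v` of the cone dual to `M` have coordinates, in the eigenbasis of `M`, in the standard
cone whose squared widths are the eigenvalues of `N`. -/
lemma eigencoordinates_mem_cone (hM : IsSpectralDecomposition (blockMatrix a N) l V)
    (hl : Antitone l) (hV : 0 < V 0 0) (hN : ∀ v, 0 ≤ v ⬝ᵥ N *ᵥ v) {μ : Fin n → ℝ}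
    {Q : Matrix (Fin n) (Fin n) ℝ} (hQ : IsSpectralDecomposition N μ Q) (hμ : Monotone μ)
    (hμpos : ∀ i, 0 < μ i) {v : Fin (n + 1) → ℝ} (hv0 : 0 ≤ v 0) (r : Fin n → ℝ)
    (hr : N *ᵥ r = v 0 • a - Fin.tail v) (hrv : r ⬝ᵥ N *ᵥ r ≤ v 0 ^ 2) :
    0 ≤ (Vᵀ *ᵥ v) 0 ∧
      ∑ i : Fin n, (Vᵀ *ᵥ v) i.succ ^ 2 / μ i ≤ (Vᵀ *ᵥ v) 0 ^ 2 := by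
  -- This is the preimage of `v` under `M`, and its form `u'Mu = v₀² - r'Nr` is nonnegative.
  set u : Fin (n + 1) → ℝ := Fin.cons (v 0 - a ⬝ᵥ r) r with hu
  have hut : Fin.tail u = r := Fin.tail_cons _ _
  have hu0 : u 0 = v 0 - a ⬝ᵥ r := rfl
  have huv : blockMatrix a N *ᵥ u = v := by
    ext i
    refine Fin.cases ?_ (fun j => ?_) i
    · rw [blockMatrix_mulVec_zero, hut, hu0]; ring
    · rw [blockMatrix_mulVec_succ, hut, hu0, hr]
      simp only [Pi.sub_apply, Pi.smul_apply, smul_eq_mul, Fin.tail]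
      ring
  have hvc : ∀ i, (Vᵀ *ᵥ v) i = l i * (Vᵀ *ᵥ u) i := fun i => by
    rw [← huv, hM.transpose_mulVec]
  have hform : 0 ≤ ∑ i, l i * ((Vᵀ *ᵥ u) i * (Vᵀ *ᵥ u) i) := by
    rw [← hM.dotProduct_mulVec, dotProduct_blockMatrix_mulVec, hut, hu0]
    ring_nf
    linarith
  have hl0 := one_le_eigenvalue_zero hM hl
  constructor
  · set p := V.col 0 with hp
    have hp0 : p 0 = V 0 0 := rfl
    have hMp := congrFun (hM.mulVec_col 0) 0
    have hfp := hM.form_col 0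
    rw [blockMatrix_mulVec_zero, ← hp] at hMp
    rw [dotProduct_blockMatrix_mulVec, ← hp, hMp] at hfp
    simp only [Pi.smul_apply, smul_eq_mul] at hMp hfp
    have hcs := hQ.sq_dotProduct_mulVec_le (fun i => (hμpos i).le) (Fin.tail p) r
    have hpv : (Vᵀ *ᵥ v) 0 = l 0 * p 0 * v 0 - Fin.tail p ⬝ᵥ N *ᵥ r := by
      rw [hr, ← hMp, dotProduct_sub, dotProduct_smul, dotProduct_comm (Fin.tail p) a]
      have : (Vᵀ *ᵥ v) 0 = p 0 * v 0 + Fin.tail p ⬝ᵥ Fin.tail v := by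
        simp [Matrix.mulVec, dotProduct, Fin.sum_univ_succ, Fin.tail, hp]
      rw [this, smul_eq_mul]
      ring
    have hlp : 0 ≤ l 0 * p 0 * v 0 := by rw [hp0]; positivity
    -- Cauchy-Schwarz for `N`: the eigenvector equation gives `p̃'N p̃ = (l₀ p₀)² - l₀`, and `r'N r
    -- ≤ v₀²` by assumption.
    have : (Fin.tail p ⬝ᵥ N *ᵥ r) ^ 2 ≤ (l 0 * p 0 * v 0) ^ 2 := by
      refine hcs.trans ?_
      rw [mul_pow]
      exact mul_le_mul (by linarith) hrv (hN _) (sq_nonneg _)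
    rw [hpv]
    linarith [abs_le_of_sq_le_sq this hlp, le_abs_self (Fin.tail p ⬝ᵥ N *ᵥ r)]
  · rw [Fin.sum_univ_succ] at hform
    -- Each coordinate of `v` is `l` times that of `u`, and `l² / μ ≤ -l` because `-μ ≤ l ≤ 0`.
    have h1 : ∑ i : Fin n, (Vᵀ *ᵥ v) i.succ ^ 2 / μ i ≤
        -∑ i : Fin n, l i.succ * ((Vᵀ *ᵥ u) i.succ * (Vᵀ *ᵥ u) i.succ) := by
      rw [← Finset.sum_neg_distrib]
      refine Finset.sum_le_sum fun i _ => ?_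
      rw [hvc, div_le_iff₀ (hμpos i)]
      have ha := eigenvalue_succ_nonpos hM hl hN i
      have hb := neg_le_eigenvalue_succ hM hl hN hQ hμ i
      have : 0 ≤ -l i.succ * (l i.succ + μ i) * (Vᵀ *ᵥ u) i.succ ^ 2 :=
        mul_nonneg (mul_nonneg (by linarith) (by linarith)) (sq_nonneg _)
      nlinarith
    refine h1.trans ?_
    rw [hvc]
    have : l 0 * 1 * (Vᵀ *ᵥ u) 0 ^ 2 ≤ l 0 * l 0 * (Vᵀ *ᵥ u) 0 ^ 2 := by gcongr
    nlinarith

end Block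

/-! ### The half-ellipsoid update -/

/-- The matrix of the smallest ellipsoid containing half of the ellipsoid of `diagonal w`. -/
def cutMatrix {n : ℕ} (w b : Fin n → ℝ) : Matrix (Fin n) (Fin n) ℝ :=
  if n = 1 then (1 / 4 : ℝ) • Matrix.diagonal w
  else ((n : ℝ) ^ 2 / ((n : ℝ) ^ 2 - 1)) •
    (Matrix.diagonal w - (2 / ((n : ℝ) + 1)) • Matrix.vecMulVec b b)

lemma updN_eq_cutMatrix {n : ℕ} (w : Fin n → ℝ) (U : Matrix (Fin (n + 1)) (Fin (n + 1)) ℝ)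
    (δ : Vec n) : updN w U δ = cutMatrix w (updB w U δ) := rfl

/-- The vector `W g / √(g' W g)` for `W = diagonal w`. -/
def cutVector {n : ℕ} (w g : Fin n → ℝ) : Fin n → ℝ :=
  fun i => (Real.sqrt (∑ i, w i * g i ^ 2))⁻¹ * (w i * g i)

lemma width_eq_sum {n : ℕ} (w : Fin n → ℝ) (U : Matrix (Fin (n + 1)) (Fin (n + 1)) ℝ)
    (δ : Vec n) : width w U δ = ∑ i, w i * coords U δ i.succ ^ 2 := by
  simp only [width, dotProduct, Matrix.mulVec_diagonal]
  exact Finset.sum_congr rfl fun i _ => by ring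

lemma updB_eq_cutVector {n : ℕ} (w : Fin n → ℝ) (U : Matrix (Fin (n + 1)) (Fin (n + 1)) ℝ)
    (δ : Vec n) : updB w U δ = cutVector w fun i => coords U δ i.succ := by
  ext i
  simp only [updB, cutVector, width_eq_sum, Pi.smul_apply, Matrix.mulVec_diagonal, smul_eq_mul]

section Cut

variable {n : ℕ} {w b g : Fin n → ℝ}

lemma cutMatrix_mulVec (hn : n ≠ 1) (v : Fin n → ℝ) (i : Fin n) :
    (cutMatrix w b *ᵥ v) i = (n : ℝ) ^ 2 / ((n : ℝ) ^ 2 - 1) *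
      (w i * v i - 2 / ((n : ℝ) + 1) * (b i * (b ⬝ᵥ v))) := by
  rw [cutMatrix, if_neg hn, Matrix.smul_mulVec, Matrix.sub_mulVec, Matrix.smul_mulVec,
    Matrix.vecMulVec_mulVec]
  simp [Matrix.mulVec_diagonal, mul_comm]

lemma dotProduct_cutMatrix (hn : n ≠ 1) (v : Fin n → ℝ) :
    v ⬝ᵥ cutMatrix w b *ᵥ v = (n : ℝ) ^ 2 / ((n : ℝ) ^ 2 - 1) *
      (∑ i, w i * v i ^ 2 - 2 / ((n : ℝ) + 1) * (b ⬝ᵥ v) ^ 2) := by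
  rw [dotProduct]
  simp only [cutMatrix_mulVec hn]
  have : (b ⬝ᵥ v) ^ 2 = ∑ i, (b i * v i) * (b ⬝ᵥ v) := by
    rw [← Finset.sum_mul, sq]; rfl
  rw [this, Finset.mul_sum, ← Finset.sum_sub_distrib, Finset.mul_sum]
  exact Finset.sum_congr rfl fun i _ => by ring

lemma dotProduct_cutMatrix_one (hn : n = 1) (v : Fin n → ℝ) :
    v ⬝ᵥ cutMatrix w b *ᵥ v = 1 / 4 * ∑ i, w i * v i ^ 2 := by
  rw [cutMatrix, if_pos hn, Matrix.smul_mulVec, dotProduct_smul, dotProduct, smul_eq_mul]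
  congr 1
  exact Finset.sum_congr rfl fun i _ => by rw [Matrix.mulVec_diagonal]; ring

lemma sq_cutVector_dotProduct_le (hw : ∀ i, 0 ≤ w i) (v : Fin n → ℝ) :
    (cutVector w g ⬝ᵥ v) ^ 2 ≤ ∑ i, w i * v i ^ 2 := by
  set q := ∑ i, w i * g i ^ 2 with hq
  have hq0 : 0 ≤ q := Finset.sum_nonneg fun i _ => mul_nonneg (hw i) (sq_nonneg _)
  have h1 : cutVector w g ⬝ᵥ v = (Real.sqrt q)⁻¹ * ∑ i, w i * g i * v i := by
    simp only [cutVector, dotProduct, Finset.mul_sum, ← hq]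
    exact Finset.sum_congr rfl fun i _ => by ring
  have h2 : (∑ i, w i * g i * v i) ^ 2 ≤ q * ∑ i, w i * v i ^ 2 := by
    refine Finset.sum_sq_le_sum_mul_sum_of_sq_le_mul _ (fun i _ => mul_nonneg (hw i) (sq_nonneg _))
      (fun i _ => mul_nonneg (hw i) (sq_nonneg _)) fun i _ => le_of_eq (by ring)
  have h3 : 0 ≤ ∑ i, w i * v i ^ 2 :=
    Finset.sum_nonneg fun i _ => mul_nonneg (hw i) (sq_nonneg _)
  rw [h1, mul_pow, inv_pow, Real.sq_sqrt hq0]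
  -- For `q = 0` the inverse is `0` by convention, so the left side vanishes.
  rcases hq0.eq_or_lt with h | h
  · rw [← h]; simpa using h3
  · rwa [inv_mul_le_iff₀ h]

lemma sum_cutVector_sq_div (hw : ∀ i, 0 < w i) (hq : 0 < ∑ i, w i * g i ^ 2) :
    ∑ i, cutVector w g i ^ 2 / w i = 1 := by
  have : ∀ i, cutVector w g i ^ 2 / w i = (∑ i, w i * g i ^ 2)⁻¹ * (w i * g i ^ 2) := by
    intro i
    rw [cutVector, mul_pow, inv_pow, Real.sq_sqrt hq.le]
    have := (hw i).ne'
    field_simp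
  simp only [this]
  rw [← Finset.mul_sum, inv_mul_cancel₀ hq.ne']

lemma one_lt_sq_natCast (hn : 2 ≤ n) : (1 : ℝ) < (n : ℝ) ^ 2 := by
  have : (2 : ℝ) ≤ n := by exact_mod_cast hn
  nlinarith

/-- The subtracted rank-one form has the factor `2/(n+1) ≤ 1` for `n ≥ 2`, and `b b'` is dominated
by `W`. Zero widths are allowed, so semidefiniteness needs nothing about the run. -/
lemma cutMatrix_nonneg (hb : ∀ v : Fin n → ℝ, (b ⬝ᵥ v) ^ 2 ≤ ∑ i, w i * v i ^ 2)
    (v : Fin n → ℝ) : 0 ≤ v ⬝ᵥ cutMatrix w b *ᵥ v := by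
  have h0 : 0 ≤ ∑ i, w i * v i ^ 2 := (sq_nonneg _).trans (hb v)
  rcases lt_trichotomy n 1 with hn | hn | hn
  · obtain rfl : n = 0 := by omega
    simp [dotProduct]
  · rw [dotProduct_cutMatrix_one hn]; positivity
  · rw [dotProduct_cutMatrix hn.ne']
    have h1 := one_lt_sq_natCast hn
    have h2 : (2 : ℝ) ≤ n := by exact_mod_cast hn
    refine mul_nonneg (div_nonneg (sq_nonneg _) (by linarith)) ?_
    have h3 : 2 / ((n : ℝ) + 1) ≤ 1 := by rw [div_le_one (by linarith)]; linarith
    have h4 := mul_le_mul_of_nonneg_right h3 (sq_nonneg (b ⬝ᵥ v))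
    linarith [hb v]

/-- The half ellipsoid `{z : z' W⁻¹ z ≤ y², b' W⁻¹ z ≥ 0}` lies in the ellipsoid of the cut matrix
centered at `y b / (n + 1)`. -/
lemma exists_cutMatrix_mulVec_eq (hn : n ≠ 0) (hw : ∀ i, 0 < w i)
    (hb : ∑ i, b i ^ 2 / w i = 1) {y : ℝ} {z : Fin n → ℝ} (hy : 0 ≤ y)
    (hz : ∑ i, z i ^ 2 / w i ≤ y ^ 2) (ht : 0 ≤ ∑ i, b i * z i / w i) :
    ∃ r : Fin n → ℝ, cutMatrix w b *ᵥ r = y • (((n : ℝ) + 1)⁻¹ • b) - z ∧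
      r ⬝ᵥ cutMatrix w b *ᵥ r ≤ y ^ 2 := by
  have hty : ∑ i, b i * z i / w i ≤ y := by
    refine abs_le_of_sq_le_sq' ?_ hy |>.2
    refine le_trans (Finset.sum_sq_le_sum_mul_sum_of_sq_le_mul _ (f := fun i => b i ^ 2 / w i)
      (g := fun i => z i ^ 2 / w i) (fun i _ => div_nonneg (sq_nonneg _) (hw i).le)
      (fun i _ => div_nonneg (sq_nonneg _) (hw i).le) fun i _ => le_of_eq (by ring)) ?_
    rw [hb, one_mul]
    exact hz
  set t := ∑ i, b i * z i / w i with ht_def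
  rcases Nat.lt_or_ge n 2 with hn1 | hn2
  · obtain rfl : n = 1 := by omega
    simp only [Finset.univ_unique, Fin.default_eq_zero, Finset.sum_singleton] at hb hz ht_def
    have hw0 := hw 0
    have hbw : b 0 ^ 2 = w 0 := by rwa [div_eq_one_iff_eq hw0.ne'] at hb
    have hzt : z 0 = t * b 0 := by
      rw [ht_def, div_mul_eq_mul_div, eq_div_iff hw0.ne', ← hbw]; ring
    refine ⟨fun i => 4 * (y * ((2 : ℝ)⁻¹ * b i) - z i) / w i, ?_, ?_⟩
    · ext i
      obtain rfl : i = 0 := Subsingleton.elim _ _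
      rw [cutMatrix, if_pos rfl, Matrix.smul_mulVec]
      simp only [Pi.smul_apply, Matrix.mulVec_diagonal, smul_eq_mul, Pi.sub_apply, Nat.cast_one]
      field_simp
      ring
    · rw [dotProduct_cutMatrix_one rfl]
      simp only [Finset.univ_unique, Fin.default_eq_zero, Finset.sum_singleton]
      -- In dimension one the slice is an interval with `z = t b`, and the kept half `0 ≤ t ≤ y` is
      -- the interval of half the length centered at `y b / 2`.
      have : 1 / 4 * (w 0 * (4 * (y * ((2 : ℝ)⁻¹ * b 0) - z 0) / w 0) ^ 2) =
          (y - 2 * t) ^ 2 := by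
        rw [hzt]
        field_simp
        rw [hbw]; ring
      rw [this]
      nlinarith
  · have hN1 := one_lt_sq_natCast hn2
    have hN2 : (2 : ℝ) ≤ n := by exact_mod_cast hn2
    set N : ℝ := (n : ℝ) with hN
    have e1 : N - 1 ≠ 0 := by linarith
    have e2 : N + 1 ≠ 0 := by linarith
    have e3 : N ^ 2 - 1 ≠ 0 := by linarith
    have e4 : N ≠ 0 := by linarith
    set s : Fin n → ℝ := y • ((N + 1)⁻¹ • b) - z with hs
    have hsi : ∀ i, s i = y / (N + 1) * b i - z i := fun i => by
      simp only [hs, Pi.sub_apply, Pi.smul_apply, smul_eq_mul]; ring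
    have hβ : ∑ i, b i * s i / w i = y / (N + 1) - t := by
      have : ∀ i, b i * s i / w i = y / (N + 1) * (b i ^ 2 / w i) - b i * z i / w i := fun i => by
        rw [hsi]; ring
      simp only [this, Finset.sum_sub_distrib, ← Finset.mul_sum, hb]
      rw [← ht_def]; ring
    have hss : ∑ i, s i ^ 2 / w i = (y / (N + 1)) ^ 2 - 2 * (y / (N + 1)) * t +
        ∑ i, z i ^ 2 / w i := by
      have : ∀ i, s i ^ 2 / w i = (y / (N + 1)) ^ 2 * (b i ^ 2 / w i) -
          2 * (y / (N + 1)) * (b i * z i / w i) + z i ^ 2 / w i := fun i => by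
        rw [hsi]; ring
      simp only [this, Finset.sum_add_distrib, Finset.sum_sub_distrib, ← Finset.mul_sum, hb]
      rw [← ht_def]; ring
    set β := y / (N + 1) - t with hβ_def
    -- The inverse of the cut matrix applied to `s`, by the Sherman-Morrison formula with `b'W⁻¹b =
    -- 1`.
    set r : Fin n → ℝ := fun i =>
      (N ^ 2 - 1) / N ^ 2 * (s i / w i + 2 / (N - 1) * (b i / w i * β)) with hr
    have hbr : b ⬝ᵥ r = (N ^ 2 - 1) / N ^ 2 * (β + 2 / (N - 1) * β) := by
      have : ∀ i, b i * r i = (N ^ 2 - 1) / N ^ 2 *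
          (b i * s i / w i + 2 / (N - 1) * β * (b i ^ 2 / w i)) := fun i => by
        rw [hr]; ring
      simp only [dotProduct, this, ← Finset.mul_sum, Finset.sum_add_distrib, hb, hβ, mul_one]
    have hNr : cutMatrix w b *ᵥ r = s := by
      ext i
      have hwi := (hw i).ne'
      rw [cutMatrix_mulVec (by omega), hbr]
      simp only [hr, ← hN]
      field_simp
      ring
    refine ⟨r, hNr, ?_⟩
    rw [hNr]
    have : r ⬝ᵥ s = (N ^ 2 - 1) / N ^ 2 * (∑ i, s i ^ 2 / w i + 2 / (N - 1) * β ^ 2) := by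
      have h : ∀ i, r i * s i = (N ^ 2 - 1) / N ^ 2 *
          (s i ^ 2 / w i + 2 / (N - 1) * β * (b i * s i / w i)) := fun i => by
        rw [hr]; ring
      simp only [dotProduct, h, ← Finset.mul_sum, Finset.sum_add_distrib, hβ]
      ring
    rw [this, hss, hβ_def]
    -- The slack on the boundary of the ellipsoid is a positive multiple of `t (y - t)`. The factor
    -- `t ≥ 0` is the half-space condition, and `t ≤ y` is Cauchy-Schwarz.
    have hid : y ^ 2 - (N ^ 2 - 1) / N ^ 2 * ((y / (N + 1)) ^ 2 - 2 * (y / (N + 1)) * t + y ^ 2 +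
        2 / (N - 1) * (y / (N + 1) - t) ^ 2) = 2 * (N + 1) / N ^ 2 * (t * (y - t)) := by
      field_simp
      ring
    have hnn : 0 ≤ 2 * (N + 1) / N ^ 2 * (t * (y - t)) :=
      mul_nonneg (by positivity) (mul_nonneg ht (by linarith))
    have hmono : (N ^ 2 - 1) / N ^ 2 * ((y / (N + 1)) ^ 2 - 2 * (y / (N + 1)) * t +
        ∑ i, z i ^ 2 / w i + 2 / (N - 1) * (y / (N + 1) - t) ^ 2) ≤
        (N ^ 2 - 1) / N ^ 2 * ((y / (N + 1)) ^ 2 - 2 * (y / (N + 1)) * t + y ^ 2 +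
        2 / (N - 1) * (y / (N + 1) - t) ^ 2) := by
      refine mul_le_mul_of_nonneg_left (by linarith) (div_nonneg (by linarith) (sq_nonneg _))
    linarith

/-! ### Decrease of the determinant -/

/-- `log (1 + x) - log (1 - x)` dominates its linear approximation strongly enough for
`x² + x log ((1 - x) / (1 + x)) ≤ log (1 - x²)`. -/
lemma sq_add_mul_log_le {x : ℝ} (hx0 : 0 ≤ x) (hx1 : x < 1) :
    x ^ 2 + x * (Real.log (1 - x) - Real.log (1 + x)) ≤ Real.log (1 - x ^ 2) := by
  have hx : |x| < 1 := by rwa [abs_of_nonneg hx0]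
  have hx2 : |x ^ 2| < 1 := by
    rw [abs_of_nonneg (sq_nonneg x)]; nlinarith
  have h1 := (Real.hasSum_log_sub_log_of_abs_lt_one hx).mul_left x
  have h2 := Real.hasSum_pow_div_log_of_abs_lt_one hx2
  have h3 := h1.sub h2
  -- The power series of `x (log (1+x) - log (1-x)) + log (1-x²)` has nonnegative terms, since
  -- `2/(2k+1) ≥ 1/(k+1)`. Its term `k = 0` is `2x² - x² = x²`.
  have h4 := sum_le_hasSum {0} (fun k _ => ?_) h3
  · simp only [Finset.sum_singleton] at h4
    norm_num at h4
    nlinarith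
  · rw [sub_nonneg, div_eq_mul_one_div]
    have e : x * (2 * (1 / (2 * (k : ℝ) + 1)) * x ^ (2 * k + 1)) =
        (x ^ 2) ^ (k + 1) * (2 / (2 * (k : ℝ) + 1)) := by ring
    rw [e]
    refine mul_le_mul_of_nonneg_left ?_ (by positivity)
    rw [div_le_div_iff₀ (by positivity) (by positivity)]
    linarith

/-- With `x = 1/n` the left side is `(1-x²)⁻ⁿ (1-x)/(1+x)`. Its logarithm is bounded by `n` times
the preceding inequality, as `n x = 1`. -/
lemma cut_volume_ratio_le (hn : 2 ≤ n) :
    ((n : ℝ) ^ 2 / ((n : ℝ) ^ 2 - 1)) ^ n * (1 - 2 / ((n : ℝ) + 1)) ≤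
      Real.exp (-(1 / (n : ℝ))) := by
  have hN1 := one_lt_sq_natCast hn
  have hN2 : (2 : ℝ) ≤ n := by exact_mod_cast hn
  have hN0 : (0 : ℝ) < n := by linarith
  have hx1 : 1 / (n : ℝ) < 1 := by rw [div_lt_one hN0]; linarith
  have key := sq_add_mul_log_le (x := 1 / (n : ℝ)) (by positivity) hx1
  have e1 : 1 - 2 / ((n : ℝ) + 1) = (1 - 1 / (n : ℝ)) / (1 + 1 / (n : ℝ)) := by
    field_simp; ring
  have e2 : (n : ℝ) ^ 2 / ((n : ℝ) ^ 2 - 1) = (1 - (1 / (n : ℝ)) ^ 2)⁻¹ := by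
    have : (n : ℝ) ^ 2 - 1 ≠ 0 := by linarith
    field_simp
  have p1 : 0 < 1 - (1 / (n : ℝ)) ^ 2 := by
    have : 0 < 1 / (n : ℝ) := by positivity
    nlinarith
  have p2 : 0 < 1 - 1 / (n : ℝ) := by linarith
  have p3 : 0 < 1 + 1 / (n : ℝ) := by positivity
  rw [e1, e2, ← Real.log_le_iff_le_exp (by positivity),
    Real.log_mul (by positivity) (by positivity), Real.log_pow, Real.log_inv, Real.log_div p2.ne' p3.ne']
  set x := 1 / (n : ℝ) with hx
  have hxn : (n : ℝ) * x = 1 := by rw [hx]; field_simp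
  have := mul_le_mul_of_nonneg_left key hN0.le
  have e3 : (n : ℝ) * (x ^ 2 + x * (Real.log (1 - x) - Real.log (1 + x))) =
      (n * x) * x + (n * x) * (Real.log (1 - x) - Real.log (1 + x)) := by ring
  rw [e3, hxn] at this
  linarith

/-- The matrix determinant lemma after factoring out `W`, again with `b'W⁻¹b = 1`. -/
lemma det_cutMatrix (hn : n ≠ 1) (hw : ∀ i, 0 < w i) (hb : ∑ i, b i ^ 2 / w i = 1) :
    (cutMatrix w b).det = ((n : ℝ) ^ 2 / ((n : ℝ) ^ 2 - 1)) ^ n *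
      ((1 - 2 / ((n : ℝ) + 1)) * ∏ i, w i) := by
  have : Matrix.diagonal w - (2 / ((n : ℝ) + 1)) • Matrix.vecMulVec b b = Matrix.diagonal w *
      (1 + Matrix.replicateCol Unit (fun i => -(2 / ((n : ℝ) + 1)) * (b i / w i)) *
        Matrix.replicateRow Unit b) := by
    ext i j
    have := (hw i).ne'
    rw [Matrix.mul_add, Matrix.mul_one, Matrix.add_apply, Matrix.diagonal_mul]
    simp [Matrix.mul_apply, Matrix.vecMulVec_apply]
    field_simp
    ring
  rw [cutMatrix, if_neg hn, Matrix.det_smul, this, Matrix.det_mul, Matrix.det_diagonal,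
    Matrix.det_one_add_replicateCol_mul_replicateRow, Fintype.card_fin]
  have h2 : b ⬝ᵥ (fun i => -(2 / ((n : ℝ) + 1)) * (b i / w i)) = -(2 / ((n : ℝ) + 1)) := by
    have : ∀ i, b i * (-(2 / ((n : ℝ) + 1)) * (b i / w i)) =
        -(2 / ((n : ℝ) + 1)) * (b i ^ 2 / w i) := fun i => by ring
    simp only [dotProduct, this, ← Finset.mul_sum, hb, mul_one]
  rw [h2]
  ring

lemma det_cutMatrix_le (hn : n ≠ 0) (hw : ∀ i, 0 < w i) (hb : ∑ i, b i ^ 2 / w i = 1) :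
    (cutMatrix w b).det ≤ Real.exp (-(1 / (n : ℝ))) * ∏ i, w i := by
  have hp : 0 ≤ ∏ i, w i := Finset.prod_nonneg fun i _ => (hw i).le
  by_cases hn1 : n = 1
  · subst hn1
    rw [cutMatrix, if_pos rfl, Matrix.det_smul, Matrix.det_diagonal]
    refine mul_le_mul_of_nonneg_right ?_ hp
    have h1 : Real.exp 1 ≤ 4 := by linarith [Real.exp_one_lt_d9]
    rw [Nat.cast_one, div_one, Real.exp_neg, Fintype.card_fin, pow_one, ← one_div]
    exact one_div_le_one_div_of_le (Real.exp_pos 1) h1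
  · rw [det_cutMatrix hn1 hw hb, ← mul_assoc]
    exact mul_le_mul_of_nonneg_right (cut_volume_ratio_le (by omega)) hp

lemma IsSpectralDecomposition.det_eq {A Q : Matrix (Fin n) (Fin n) ℝ} {μ : Fin n → ℝ}
    (h : IsSpectralDecomposition A μ Q) : A.det = ∏ i, μ i := by
  rw [h.2, Matrix.det_mul, mul_comm, ← Matrix.det_mul, ← Matrix.mul_assoc,
    transpose_mul_self_of_orthogonal h.1, Matrix.one_mul, Matrix.det_diagonal]

/-! ### Lower bound on the eigenvalues -/

/-- Split `W = m I + (W - m I)` and `b'v = p + s` accordingly. The excess absorbs `s²`, while `p²`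
is tiny compared with `m |v|²` because the width `q` is large compared with `m`. The remaining loss
is at most `m |v|² / n²`, which the dilation factor `n²/(n²-1)` makes up for. -/
lemma le_dotProduct_cutMatrix (hn : n ≠ 0) {m : ℝ} (hm : 0 ≤ m) (hw : ∀ i, m ≤ w i)
    (hg : ∑ i, g i ^ 2 ≤ 1) (hq : 0 < ∑ i, w i * g i ^ 2)
    (hmq : 4 * (n : ℝ) ^ 2 * m ≤ ∑ i, w i * g i ^ 2) (v : Fin n → ℝ) :
    m * ∑ i, v i ^ 2 ≤ v ⬝ᵥ cutMatrix w (cutVector w g) *ᵥ v := by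
  set q := ∑ i, w i * g i ^ 2 with hq_def
  by_cases hn1 : n = 1
  · subst hn1
    rw [dotProduct_cutMatrix_one rfl]
    simp only [Finset.univ_unique, Fin.default_eq_zero, Finset.sum_singleton, Nat.cast_one]
      at hg hmq hq_def ⊢
    have h0 := hw 0
    have h1 : w 0 * g 0 ^ 2 ≤ w 0 := mul_le_of_le_one_right (hm.trans h0) hg
    have h2 : 4 * m ≤ w 0 := by linarith
    nlinarith [mul_le_mul_of_nonneg_right h2 (sq_nonneg (v 0))]
  have hn2 : 2 ≤ n := by omega
  have hN1 := one_lt_sq_natCast hn2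
  have hN2 : (2 : ℝ) ≤ n := by exact_mod_cast hn2
  rw [dotProduct_cutMatrix hn1]
  set N : ℝ := (n : ℝ) with hN
  set S := ∑ i, v i ^ 2 with hS
  have hS0 : 0 ≤ S := Finset.sum_nonneg fun i _ => sq_nonneg _
  set R := ∑ i, (w i - m) * v i ^ 2 with hR
  have hA : ∑ i, w i * v i ^ 2 = m * S + R := by
    rw [hS, hR, Finset.mul_sum, ← Finset.sum_add_distrib]
    exact Finset.sum_congr rfl fun i _ => by ring
  set p := (Real.sqrt q)⁻¹ * (m * ∑ i, g i * v i) with hp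
  set s := (Real.sqrt q)⁻¹ * ∑ i, (w i - m) * g i * v i with hs
  have hbv : cutVector w g ⬝ᵥ v = p + s := by
    rw [hp, hs, ← mul_add, Finset.mul_sum, ← Finset.sum_add_distrib, dotProduct, Finset.mul_sum]
    refine Finset.sum_congr rfl fun i _ => ?_
    rw [cutVector, ← hq_def]; ring
  have hp2 : 4 * N ^ 2 * p ^ 2 ≤ m * S := by
    have h1 : (∑ i, g i * v i) ^ 2 ≤ S :=
      (Finset.sum_mul_sq_le_sq_mul_sq _ _ _).trans (mul_le_of_le_one_left hS0 hg)
    have h2 : p ^ 2 = m ^ 2 * (∑ i, g i * v i) ^ 2 / q := by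
      rw [hp, mul_pow, inv_pow, Real.sq_sqrt hq.le, mul_pow]; ring
    rw [h2, ← mul_div_assoc, div_le_iff₀ hq]
    calc 4 * N ^ 2 * (m ^ 2 * (∑ i, g i * v i) ^ 2)
        = (4 * N ^ 2 * m) * (m * (∑ i, g i * v i) ^ 2) := by ring
      _ ≤ q * (m * S) := by gcongr
      _ = m * S * q := by ring
  have hs2 : s ^ 2 ≤ R := by
    rw [hs, mul_pow, inv_pow, Real.sq_sqrt hq.le, inv_mul_le_iff₀ hq]
    have hnn : ∀ i, 0 ≤ w i - m := fun i => by linarith [hw i]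
    refine le_trans (Finset.sum_sq_le_sum_mul_sum_of_sq_le_mul _
      (f := fun i => (w i - m) * g i ^ 2) (g := fun i => (w i - m) * v i ^ 2)
      (fun i _ => mul_nonneg (hnn i) (sq_nonneg _)) (fun i _ => mul_nonneg (hnn i) (sq_nonneg _))
      fun i _ => le_of_eq (by ring)) ?_
    refine mul_le_mul_of_nonneg_right ?_
      (Finset.sum_nonneg fun i _ => mul_nonneg (hnn i) (sq_nonneg _))
    refine Finset.sum_le_sum fun i _ => ?_
    nlinarith [sq_nonneg (g i)]
  rw [hA, hbv]
  -- The weight `2/(N-1)` of `p²` is the one for which the difference of both sides is a perfect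
  -- square.
  have hquad : 2 / (N + 1) * (p + s) ^ 2 ≤ s ^ 2 + 2 / (N - 1) * p ^ 2 := by
    have e1 : N - 1 ≠ 0 := by linarith
    have e2 : N + 1 ≠ 0 := by linarith
    have : s ^ 2 + 2 / (N - 1) * p ^ 2 - 2 / (N + 1) * (p + s) ^ 2 =
        ((N - 1) * s - 2 * p) ^ 2 / ((N - 1) * (N + 1)) := by
      field_simp
      ring
    have h : 0 ≤ ((N - 1) * s - 2 * p) ^ 2 / ((N - 1) * (N + 1)) :=
      div_nonneg (sq_nonneg _) (mul_nonneg (by linarith) (by linarith))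
    linarith
  have hp3 : 2 / (N - 1) * p ^ 2 ≤ m * S / N ^ 2 := by
    rw [le_div_iff₀ (by positivity)]
    have : 2 / (N - 1) ≤ 2 := by
      rw [div_le_iff₀ (by linarith)]; linarith
    have := mul_le_mul_of_nonneg_right this (mul_nonneg (sq_nonneg p) (sq_nonneg N))
    nlinarith [mul_nonneg (sq_nonneg p) (sq_nonneg N)]
  have hfin : m * S = N ^ 2 / (N ^ 2 - 1) * (m * S - m * S / N ^ 2) := by
    have e1 : N ^ 2 - 1 ≠ 0 := by linarith
    field_simp
  calc m * S = N ^ 2 / (N ^ 2 - 1) * (m * S - m * S / N ^ 2) := hfin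
    _ ≤ _ := mul_le_mul_of_nonneg_left (by linarith) (div_nonneg (sq_nonneg _) (by linarith))

lemma IsSpectralDecomposition.le_eigenvalue {A Q : Matrix (Fin n) (Fin n) ℝ} {μ : Fin n → ℝ}
    (h : IsSpectralDecomposition A μ Q) {m : ℝ}
    (hA : ∀ v : Fin n → ℝ, m * ∑ i, v i ^ 2 ≤ v ⬝ᵥ A *ᵥ v) (i : Fin n) : m ≤ μ i := by
  have h1 := hA (Q.col i)
  rw [h.form_col] at h1
  have h2 := dotProduct_col_self h.1 i
  simp only [dotProduct, ← sq] at h2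
  rwa [h2, mul_one] at h1

end Cut

/-! ### Coordinates -/

section Coords

variable {n : ℕ} {U : Matrix (Fin (n + 1)) (Fin (n + 1)) ℝ} {w : Fin n → ℝ}

/-- The axis `U e₁` of an ellipsoidal cone. -/
def axis (U : Matrix (Fin (n + 1)) (Fin (n + 1)) ℝ) : Vec n := WithLp.toLp 2 fun i => U i 0

lemma coords_dotProduct (hU : U ∈ Matrix.orthogonalGroup (Fin (n + 1)) ℝ) (c v : Vec n) :
    coords U c ⬝ᵥ coords U v = inner ℝ c v := by
  rw [coords, coords, dotProduct_transpose_mulVec hU, EuclideanSpace.inner_eq_star_dotProduct,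
    star_trivial, dotProduct_comm]

lemma coords_zero (U : Matrix (Fin (n + 1)) (Fin (n + 1)) ℝ) (c : Vec n) :
    coords U c 0 = inner ℝ c (axis U) := by
  rw [EuclideanSpace.inner_eq_star_dotProduct, star_trivial]
  rfl

lemma coords_mulVec (hU : U ∈ Matrix.orthogonalGroup (Fin (n + 1)) ℝ) (y : Fin (n + 1) → ℝ) :
    coords U (WithLp.toLp 2 (U *ᵥ y)) = y := transpose_mulVec_mulVec hU y

lemma coords_mul (U V : Matrix (Fin (n + 1)) (Fin (n + 1)) ℝ) (c : Vec n) :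
    coords (U * V) c = Vᵀ *ᵥ coords U c := by
  rw [coords, coords, Matrix.mulVec_mulVec, Matrix.transpose_mul]

lemma norm_sq_eq_coords (hU : U ∈ Matrix.orthogonalGroup (Fin (n + 1)) ℝ) (c : Vec n) :
    ‖c‖ ^ 2 = coords U c 0 ^ 2 + ∑ i : Fin n, coords U c i.succ ^ 2 := by
  rw [← real_inner_self_eq_norm_sq, ← coords_dotProduct hU, dotProduct, Fin.sum_univ_succ]
  simp only [sq]

lemma inner_eq_coords (hU : U ∈ Matrix.orthogonalGroup (Fin (n + 1)) ℝ) (c v : Vec n) :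
    inner ℝ c v = coords U c 0 * coords U v 0 +
      ∑ i : Fin n, coords U c i.succ * coords U v i.succ := by
  rw [← coords_dotProduct hU, dotProduct, Fin.sum_univ_succ]

lemma norm_axis (hU : U ∈ Matrix.orthogonalGroup (Fin (n + 1)) ℝ) : ‖axis U‖ = 1 := by
  have h : ‖axis U‖ ^ 2 = 1 := by
    rw [← real_inner_self_eq_norm_sq, EuclideanSpace.inner_eq_star_dotProduct, star_trivial]
    exact dotProduct_col_self hU 0
  exact (pow_eq_one_iff_of_nonneg (norm_nonneg _) two_ne_zero).1 h

/-! ### The circumcenter of an ellipsoidal cone -/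

lemma theta_nonneg (c v : Vec n) : 0 ≤ theta c v := by
  unfold theta
  split_ifs
  · exact le_rfl
  · exact InnerProductGeometry.angle_nonneg _ _

lemma theta_le_pi (c v : Vec n) : theta c v ≤ Real.pi := by
  unfold theta
  split_ifs
  · exact Real.pi_pos.le
  · exact InnerProductGeometry.angle_le_pi _ _

lemma theta_of_ne_zero {c : Vec n} (hc : c ≠ 0) (v : Vec n) :
    theta c v = Real.arccos (inner ℝ c v / (‖c‖ * ‖v‖)) := if_neg hc

lemma theta_le_iSup {C : Set (Vec n)} {c : Vec n} (hc : c ∈ C) (v : Vec n) :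
    theta c v ≤ ⨆ c : C, theta (c : Vec n) v :=
  le_ciSup (f := fun c : C => theta (c : Vec n) v)
    ⟨Real.pi, by rintro _ ⟨c, rfl⟩; exact theta_le_pi _ _⟩ ⟨c, hc⟩

/-- Here `σ` is the largest squared width and `z` an end of a longest semiaxis, with the sign chosen
against `h`. For `n = 0` the cone is a ray and `σ = 0`. -/
lemma exists_width_bound (hw : ∀ i, 0 ≤ w i) : ∃ σ : ℝ, 0 ≤ σ ∧ (∀ i, w i ≤ σ) ∧
    ∀ h : Fin n → ℝ, ∃ z : Fin n → ℝ, ∑ i, z i * h i ≤ 0 ∧ ∑ i, z i ^ 2 = σ ∧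
      (∀ i, w i = 0 → z i = 0) ∧ ∑ i, z i ^ 2 / w i ≤ 1 := by
  rcases isEmpty_or_nonempty (Fin n) with hn | hn
  · exact ⟨0, le_rfl, fun i => hn.elim i, fun h => ⟨0, by simp, by simp, by simp, by simp⟩⟩
  obtain ⟨k, hk⟩ := Finite.exists_max w
  refine ⟨w k, hw k, hk, fun h => ?_⟩
  obtain ⟨r, hr, hrh⟩ : ∃ r : ℝ, r ^ 2 = w k ∧ r * h k ≤ 0 := by
    rcases le_total 0 (h k) with h0 | h0
    · exact ⟨-Real.sqrt (w k), by rw [neg_sq, Real.sq_sqrt (hw k)],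
        mul_nonpos_of_nonpos_of_nonneg (neg_nonpos.2 (Real.sqrt_nonneg _)) h0⟩
    · exact ⟨Real.sqrt (w k), Real.sq_sqrt (hw k),
        mul_nonpos_of_nonneg_of_nonpos (Real.sqrt_nonneg _) h0⟩
  refine ⟨Pi.single k r, ?_, ?_, ?_, ?_⟩
  · simpa [Pi.single_apply] using hrh
  · simpa [Pi.single_apply] using hr
  · intro i hi
    by_cases hik : i = k
    · subst hik
      rw [hi] at hr
      simpa using hr
    · simp [hik]
  · rw [Finset.sum_eq_single k (by intro b _ hb; simp [hb]) (by simp)]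
    simp only [Pi.single_eq_same, hr]
    -- The quotient is `0` rather than `1` if all widths vanish.
    exact div_self_le_one _

/-- From the axis, the farthest rays are the ends of a longest semiaxis, at the angle `arccos
(1/√(1+σ))`. From any other unit vector, the end on its far side is strictly farther. Uniqueness
forces every run to announce the axis. -/
lemma isCircumcenter_ellipsoidalCone (hU : U ∈ Matrix.orthogonalGroup (Fin (n + 1)) ℝ)
    (hw : ∀ i, 0 ≤ w i) (v : Vec n) :
    IsCircumcenter (ellipsoidalCone w U) v ↔ v = axis U := by
  obtain ⟨σ, hσ, hwσ, hz⟩ := exists_width_bound hw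
  have hσ1 : 0 < 1 + σ := by linarith
  have hs : 0 < Real.sqrt (1 + σ) := Real.sqrt_pos.2 hσ1
  set ρ := Real.arccos (1 / Real.sqrt (1 + σ)) with hρ
  have hlow : ∀ v : Vec n, ‖v‖ = 1 → ∃ c ∈ ellipsoidalCone w U,
      theta c v = Real.arccos (inner ℝ c v / Real.sqrt (1 + σ)) ∧
        -- The vector `c = U (1, z)` has first coordinate `1` and a tail pointing away from that of
        -- `v`, so only the axis part can contribute positively.
        inner ℝ c v ≤ inner ℝ v (axis U) ∧ -1 ≤ inner ℝ c v / Real.sqrt (1 + σ) := by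
    intro v hv
    obtain ⟨z, hzh, hzσ, hz0, hz1⟩ := hz fun i => coords U v i.succ
    set c : Vec n := WithLp.toLp 2 (U *ᵥ (Fin.cons 1 z)) with hc
    have hcc : coords U c = Fin.cons 1 z := coords_mulVec hU _
    have hcn : ‖c‖ = Real.sqrt (1 + σ) := by
      rw [eq_comm, Real.sqrt_eq_iff_eq_sq hσ1.le (norm_nonneg _), norm_sq_eq_coords hU, hcc]
      simp [hzσ]
    have hc0 : c ≠ 0 := by
      rw [← norm_pos_iff, hcn]; exact hs
    have hnorm := abs_real_inner_div_norm_mul_norm_le_one c v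
    rw [hv, mul_one, hcn] at hnorm
    refine ⟨c, ⟨?_, ?_, ?_⟩, ?_, ?_, (abs_le.1 hnorm).1⟩
    · rw [hcc]; simp
    · intro i hi
      rw [hcc]; simpa using hz0 i hi
    · rw [hcc]; simpa using hz1
    · rw [theta_of_ne_zero hc0, hv, mul_one, hcn]
    · rw [inner_eq_coords hU, hcc, ← coords_zero]
      simpa using hzh
  have hge : ∀ v : Vec n, ‖v‖ = 1 → ρ ≤ ⨆ c : ellipsoidalCone w U, theta (c : Vec n) v := by
    intro v hv
    obtain ⟨c, hcE, hth, hle, -⟩ := hlow v hv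
    refine le_trans ?_ (theta_le_iSup hcE v)
    rw [hth]
    refine Real.arccos_le_arccos (div_le_div_of_nonneg_right (hle.trans ?_) hs.le)
    have := real_inner_le_norm v (axis U)
    rwa [hv, norm_axis hU, one_mul] at this
  have haxis : ⨆ c : ellipsoidalCone w U, theta (c : Vec n) (axis U) ≤ ρ := by
    have : Nonempty (ellipsoidalCone w U) := by
      obtain ⟨c, hc, -⟩ := hlow (axis U) (norm_axis hU)
      exact ⟨⟨c, hc⟩⟩
    refine ciSup_le fun c => ?_
    obtain ⟨c, hc0, hcz, hcs⟩ := c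
    show theta c (axis U) ≤ ρ
    by_cases hc : c = 0
    · rw [theta, if_pos hc]; exact Real.arccos_nonneg _
    rw [theta_of_ne_zero hc, ← coords_zero, norm_axis hU, mul_one]
    refine Real.arccos_le_arccos ?_
    rw [div_le_div_iff₀ hs (norm_pos_iff.2 hc), one_mul]
    refine abs_le_of_sq_le_sq' ?_ (by positivity) |>.2
    rw [norm_sq_eq_coords hU, mul_pow, Real.sq_sqrt hσ1.le]
    have : ∑ i : Fin n, coords U c i.succ ^ 2 ≤
        σ * ∑ i : Fin n, coords U c i.succ ^ 2 / w i := by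
      rw [Finset.mul_sum]
      refine Finset.sum_le_sum fun i _ => ?_
      rcases (hw i).eq_or_lt with h | h
      · rw [hcz i h.symm]; simp
      · rw [← mul_div_assoc, le_div_iff₀ h, mul_comm]
        exact mul_le_mul_of_nonneg_right (hwσ i) (sq_nonneg _)
    nlinarith [mul_le_mul_of_nonneg_left hcs hσ]
  have hα : uncertaintyAngle (ellipsoidalCone w U) = ρ := by
    have : Nonempty (Metric.sphere (0 : Vec n) 1) :=
      ⟨⟨axis U, by simp [norm_axis hU]⟩⟩
    refine le_antisymm ?_ (le_ciInf fun v => hge v (by simp))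
    refine ciInf_le_of_le ⟨0, ?_⟩ ⟨axis U, by simp [norm_axis hU]⟩ haxis
    rintro _ ⟨v, rfl⟩
    exact Real.iSup_nonneg fun c => theta_nonneg _ _
  constructor
  · rintro ⟨hv, hsup⟩
    by_contra hne
    obtain ⟨c, hcE, hth, hle, h1⟩ := hlow v hv
    have hlt : inner ℝ v (axis U) < (1 : ℝ) :=
      lt_of_le_of_ne (by simpa [hv, norm_axis hU] using real_inner_le_norm v (axis U))
        (mt (inner_eq_one_iff_of_norm_eq_one hv (norm_axis hU)).1 hne)
    have : ρ < theta c v := by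
      rw [hth]
      refine Real.arccos_lt_arccos h1 ?_ ?_
      · exact div_lt_div_of_pos_right (hle.trans_lt hlt) hs
      · rw [div_le_one hs]
        exact Real.one_le_sqrt.2 (by linarith)
    have h2 := theta_le_iSup hcE v
    rw [hsup, hα] at h2
    linarith
  · rintro rfl
    exact ⟨norm_axis hU, by rw [hα]; exact le_antisymm haxis (hge _ (norm_axis hU))⟩

lemma uncertaintyAngle_nonneg (C : Set (Vec n)) : 0 ≤ uncertaintyAngle C :=
  Real.iInf_nonneg fun _ => Real.iSup_nonneg fun _ => theta_nonneg _ _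

/-- A unit vector within `α` of the axis has `y₁ ≥ cos α`, so its tail satisfies `|y|² - y₁² ≤ sin²
α = tan² α cos² α ≤ tan² α y₁²`. -/
lemma mem_initial_cone (hU : U ∈ Matrix.orthogonalGroup (Fin (n + 1)) ℝ) {C₀ : Set (Vec n)}
    (hC : C₀ ⊆ Metric.sphere 0 1) (hα : uncertaintyAngle C₀ < Real.pi / 2)
    (hax : IsCircumcenter C₀ (axis U)) (hw : ∀ i, w i = Real.tan (uncertaintyAngle C₀) ^ 2)
    {c : Vec n} (hc : c ∈ C₀) : c ∈ ellipsoidalCone w U := by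
  set α := uncertaintyAngle C₀ with hα_def
  have hα0 : 0 ≤ α := uncertaintyAngle_nonneg C₀
  have hcn : ‖c‖ = 1 := by simpa using hC hc
  have hc0 : c ≠ 0 := by rw [← norm_pos_iff, hcn]; exact one_pos
  have hcos : 0 < Real.cos α := Real.cos_pos_of_mem_Ioo ⟨by linarith [Real.pi_pos], hα⟩
  have hth : theta c (axis U) ≤ α := by
    have := theta_le_iSup hc (axis U)
    rwa [hax.2] at this
  have hy : Real.cos α ≤ coords U c 0 := by
    rw [theta_of_ne_zero hc0, hcn, norm_axis hU, mul_one, div_one, ← coords_zero] at hth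
    have hab := abs_real_inner_le_norm c (axis U)
    rw [← coords_zero, hcn, norm_axis hU, mul_one] at hab
    rw [← Real.cos_arccos (abs_le.1 hab).1 (abs_le.1 hab).2]
    exact Real.cos_le_cos_of_nonneg_of_le_pi (Real.arccos_nonneg _)
      (by linarith [Real.pi_pos]) hth
  have hns := norm_sq_eq_coords hU c
  rw [hcn, one_pow] at hns
  have hcos2 : Real.cos α ^ 2 ≤ coords U c 0 ^ 2 := by gcongr
  have htan : (1 + Real.tan α ^ 2) * Real.cos α ^ 2 = 1 := by
    rw [add_mul, ← mul_pow, Real.tan_mul_cos hcos.ne', one_mul, add_comm, Real.sin_sq_add_cos_sq]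
  have hkey : ∑ i : Fin n, coords U c i.succ ^ 2 ≤ Real.tan α ^ 2 * coords U c 0 ^ 2 := by
    have := mul_le_mul_of_nonneg_left hcos2 (by positivity : 0 ≤ 1 + Real.tan α ^ 2)
    linarith
  refine ⟨hcos.le.trans hy, fun i hi => ?_, ?_⟩
  -- Zero width means `tan α = 0`; the whole tail then vanishes.
  · rw [← hw i, hi, zero_mul] at hkey
    have := (Finset.single_le_sum (f := fun i : Fin n => coords U c i.succ ^ 2)
      (fun i _ => sq_nonneg _) (Finset.mem_univ i)).trans hkey
    exact pow_eq_zero_iff two_ne_zero |>.1 (le_antisymm this (sq_nonneg _))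
  · simp only [hw]
    rw [← Finset.sum_div]
    exact div_le_of_le_mul₀ (sq_nonneg _) (sq_nonneg _) (by linarith)

/-! ### One period -/

lemma width_nonneg (hw : ∀ i, 0 ≤ w i) (δ : Vec n) : 0 ≤ width w U δ := by
  rw [width_eq_sum]
  exact Finset.sum_nonneg fun i _ => mul_nonneg (hw i) (sq_nonneg _)

lemma sum_coords_succ_sq_le (hU : U ∈ Matrix.orthogonalGroup (Fin (n + 1)) ℝ) {δ : Vec n}
    (hδ : ‖δ‖ ≤ 1) : ∑ i : Fin n, coords U δ i.succ ^ 2 ≤ 1 := by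
  have h := norm_sq_eq_coords hU δ
  nlinarith [sq_nonneg (coords U δ 0), norm_nonneg δ]

lemma width_le (hU : U ∈ Matrix.orthogonalGroup (Fin (n + 1)) ℝ) {δ : Vec n}
    (hδ : ‖δ‖ ≤ 1) {B : ℝ} (hB : 0 ≤ B) (hw : ∀ i, w i ≤ B) : width w U δ ≤ B := by
  rw [width_eq_sum]
  calc ∑ i, w i * coords U δ i.succ ^ 2 ≤ ∑ i : Fin n, B * coords U δ i.succ ^ 2 :=
        Finset.sum_le_sum fun i _ => mul_le_mul_of_nonneg_right (hw i) (sq_nonneg _)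
    _ ≤ B := by
        rw [← Finset.mul_sum]
        exact mul_le_of_le_one_right hB (sum_coords_succ_sq_le hU hδ)

/-- The product of the axis coordinates is nonpositive and can be dropped. Cauchy-Schwarz with the
weights `w` and `1/w` treats the tails, and a unit vector has `y₁² ≤ 1`. At zero widths the
coordinate of `c` vanishes, so the weighted inequality still holds. -/
lemma sq_inner_le_width (hU : U ∈ Matrix.orthogonalGroup (Fin (n + 1)) ℝ) (hw : ∀ i, 0 ≤ w i)
    {c δ : Vec n} (hc : c ∈ ellipsoidalCone w U) (hcn : ‖c‖ = 1) (hδ0 : coords U δ 0 ≤ 0)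
    (hδc : 0 ≤ inner ℝ δ c) : inner ℝ δ c ^ 2 ≤ width w U δ := by
  obtain ⟨h0, hz, hs⟩ := hc
  have h1 : inner ℝ δ c ≤ ∑ i : Fin n, coords U δ i.succ * coords U c i.succ := by
    rw [inner_eq_coords hU]
    linarith [mul_nonpos_of_nonpos_of_nonneg hδ0 h0]
  have h2 : (∑ i : Fin n, coords U δ i.succ * coords U c i.succ) ^ 2 ≤
      (∑ i, w i * coords U δ i.succ ^ 2) * ∑ i : Fin n, coords U c i.succ ^ 2 / w i := by
    refine Finset.sum_sq_le_sum_mul_sum_of_sq_le_mul _ (fun i _ => mul_nonneg (hw i) (sq_nonneg _))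
      (fun i _ => div_nonneg (sq_nonneg _) (hw i)) fun i _ => ?_
    rcases (hw i).eq_or_lt with h | h
    · rw [hz i h.symm, ← h]; simp
    · refine le_of_eq ?_
      field_simp
  have h3 : coords U c 0 ^ 2 ≤ 1 := by
    have := norm_sq_eq_coords hU c
    rw [hcn] at this
    have h4 : 0 ≤ ∑ i : Fin n, coords U c i.succ ^ 2 := Finset.sum_nonneg fun i _ => sq_nonneg _
    linarith
  calc inner ℝ δ c ^ 2 ≤ (∑ i : Fin n, coords U δ i.succ * coords U c i.succ) ^ 2 := by gcongr
    _ ≤ _ := h2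
    _ ≤ width w U δ := by
        rw [← width_eq_sum]
        exact mul_le_of_le_one_right (width_nonneg hw δ) (hs.trans h3)

lemma updN_nonneg (hw : ∀ i, 0 ≤ w i) (δ : Vec n) (v : Fin n → ℝ) :
    0 ≤ v ⬝ᵥ updN w U δ *ᵥ v := by
  rw [updN_eq_cutMatrix, updB_eq_cutVector]
  exact cutMatrix_nonneg (sq_cutVector_dotProduct_le hw) v

lemma ConeUpdate.orthogonal {δ : Vec n} {w' : Fin n → ℝ}
    {U' : Matrix (Fin (n + 1)) (Fin (n + 1)) ℝ} (h : ConeUpdate w U δ w' U')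
    (hU : U ∈ Matrix.orthogonalGroup (Fin (n + 1)) ℝ) :
    U' ∈ Matrix.orthogonalGroup (Fin (n + 1)) ℝ := by
  obtain ⟨-, l, V, -, hV, -, rfl⟩ := h
  exact Submonoid.mul_mem _ hU hV.1

lemma ConeUpdate.nonneg {δ : Vec n} {w' : Fin n → ℝ}
    {U' : Matrix (Fin (n + 1)) (Fin (n + 1)) ℝ} (h : ConeUpdate w U δ w' U')
    (hw : ∀ i, 0 ≤ w i) (i : Fin n) : 0 ≤ w' i := by
  obtain ⟨⟨-, Q, hQ⟩, -⟩ := h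
  exact hQ.nonneg (updN_nonneg hw δ) i

lemma ConeUpdate.le {δ : Vec n} {w' : Fin n → ℝ}
    {U' : Matrix (Fin (n + 1)) (Fin (n + 1)) ℝ} (h : ConeUpdate w U δ w' U')
    (hU : U ∈ Matrix.orthogonalGroup (Fin (n + 1)) ℝ) (hδ : ‖δ‖ ≤ 1) (hn : n ≠ 0) {m : ℝ}
    (hm : 0 ≤ m) (hw : ∀ i, m ≤ w i) (hq : 0 < width w U δ)
    (hmq : 4 * (n : ℝ) ^ 2 * m ≤ width w U δ) (i : Fin n) : m ≤ w' i := by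
  obtain ⟨⟨-, Q, hQ⟩, -⟩ := h
  refine hQ.le_eigenvalue (fun v => ?_) i
  rw [updN_eq_cutMatrix, updB_eq_cutVector]
  rw [width_eq_sum] at hq hmq
  exact le_dotProduct_cutMatrix hn hm hw (sum_coords_succ_sq_le hU hδ) hq hmq v

lemma ConeUpdate.prod_le {δ : Vec n} {w' : Fin n → ℝ}
    {U' : Matrix (Fin (n + 1)) (Fin (n + 1)) ℝ} (h : ConeUpdate w U δ w' U') (hn : n ≠ 0)
    (hw : ∀ i, 0 < w i) (hq : 0 < width w U δ) :
    ∏ i, w' i ≤ Real.exp (-(1 / (n : ℝ))) * ∏ i, w i := by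
  obtain ⟨⟨-, Q, hQ⟩, -⟩ := h
  rw [← hQ.det_eq, updN_eq_cutMatrix, updB_eq_cutVector]
  rw [width_eq_sum] at hq
  exact det_cutMatrix_le hn hw (sum_cutVector_sq_div hw hq)

/-- Because `δ` has a nonpositive axis coordinate, `δ'c ≥ 0` implies the same for the tails alone.
This is a cut through the center of the slice containing `c`, to which the half-ellipsoid bound
applies; the eigenbasis of `M` then straightens the tilted cone. -/
lemma ConeUpdate.mem {δ : Vec n} {w' : Fin n → ℝ}
    {U' : Matrix (Fin (n + 1)) (Fin (n + 1)) ℝ} (h : ConeUpdate w U δ w' U')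
    (hU : U ∈ Matrix.orthogonalGroup (Fin (n + 1)) ℝ) (hn : n ≠ 0)
    (hw : ∀ i, 0 < w i) (hw' : ∀ i, 0 < w' i) (hq : 0 < width w U δ) {c : Vec n}
    (hc : c ∈ ellipsoidalCone w U) (hδ0 : coords U δ 0 ≤ 0) (hδc : 0 ≤ inner ℝ δ c) :
    c ∈ ellipsoidalCone w' U' := by
  obtain ⟨⟨hmono, Q, hQ⟩, l, V, hl, hV, hV0, rfl⟩ := h
  obtain ⟨h0, -, hs⟩ := hc
  rw [updM_eq_blockMatrix] at hV
  have hb : ∑ i, updB w U δ i ^ 2 / w i = 1 := by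
    rw [width_eq_sum] at hq
    rw [updB_eq_cutVector]
    exact sum_cutVector_sq_div hw hq
  have ht : 0 ≤ ∑ i, updB w U δ i * coords U c i.succ / w i := by
    have h1 : ∀ i, updB w U δ i * coords U c i.succ / w i =
        (Real.sqrt (width w U δ))⁻¹ * (coords U δ i.succ * coords U c i.succ) := by
      intro i
      have := (hw i).ne'
      simp only [updB, Pi.smul_apply, Matrix.mulVec_diagonal, smul_eq_mul]
      field_simp
    simp only [h1]
    rw [← Finset.mul_sum]
    refine mul_nonneg (inv_nonneg.2 (Real.sqrt_nonneg _)) ?_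
    rw [inner_eq_coords hU] at hδc
    linarith [mul_nonpos_of_nonpos_of_nonneg hδ0 h0]
  obtain ⟨r, hr, hrr⟩ := exists_cutMatrix_mulVec_eq (z := Fin.tail (coords U c)) hn hw hb h0 hs ht
  rw [← updN_eq_cutMatrix] at hr hrr
  obtain ⟨k0, k1⟩ := eigencoordinates_mem_cone hV hl hV0 (updN_nonneg (fun i => (hw i).le) δ) hQ
    hmono hw' h0 r hr hrr
  refine ⟨?_, fun i hi => absurd hi (hw' i).ne', ?_⟩
  · rwa [coords_mul]
  · rwa [coords_mul]

end Coords

/-! ### Regret of a run -/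

section Regret

variable {n m T : ℕ} {C₀ : Set (Vec n)} {cstar : Vec n} {X : ℕ → Set (EuclideanSpace ℝ (Fin m))}
  {f : ℕ → EuclideanSpace ℝ (Fin m) → Vec n} {xstar x : ℕ → EuclideanSpace ℝ (Fin m)}
  {c : ℕ → Vec n} {w : ℕ → Fin n → ℝ} {U : ℕ → Matrix (Fin (n + 1)) (Fin (n + 1)) ℝ} {ε : ℝ}

lemma effectiveDiff_norm_le (f : EuclideanSpace ℝ (Fin m) → Vec n)
    (x xstar : EuclideanSpace ℝ (Fin m)) : ‖effectiveDiff f x xstar‖ ≤ 1 := by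
  rw [effectiveDiff, norm_smul, norm_inv, norm_norm]
  exact inv_mul_le_one

lemma norm_smul_effectiveDiff (f : EuclideanSpace ℝ (Fin m) → Vec n)
    (x xstar : EuclideanSpace ℝ (Fin m)) :
    ‖f x - f xstar‖ • effectiveDiff f x xstar = f x - f xstar := by
  rw [effectiveDiff, smul_smul]
  by_cases h : f x - f xstar = 0
  · simp [h]
  · rw [mul_inv_cancel₀ (norm_ne_zero_iff.2 h), one_smul]

/-- In a period in which the axis of the cone is played and the cone contains `c⋆`, the effective
difference points away from the axis and towards `c⋆`, and the regret is at most one, and at most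
the square root of the width. -/
lemma period_bounds (hX : Admissible T X f) {t : ℕ} (ht : t < T) (hcs : ‖cstar‖ = 1)
    {W : Fin n → ℝ} {O : Matrix (Fin (n + 1)) (Fin (n + 1)) ℝ}
    (hO : O ∈ Matrix.orthogonalGroup (Fin (n + 1)) ℝ) (hW : ∀ i, 0 ≤ W i)
    (hmem : cstar ∈ ellipsoidalCone W O)
    (hstar : xstar t ∈ argmins cstar (X t) (f t)) (hx : x t ∈ argmins (axis O) (X t) (f t)) :
    coords O (effectiveDiff (f t) (x t) (xstar t)) 0 ≤ 0 ∧
    0 ≤ inner ℝ (effectiveDiff (f t) (x t) (xstar t)) cstar ∧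
    inner ℝ (f t (x t) - f t (xstar t)) cstar ≤ 1 ∧
    inner ℝ (f t (x t) - f t (xstar t)) cstar ≤
      Real.sqrt (width W O (effectiveDiff (f t) (x t) (xstar t))) := by
  have hnorm : ‖f t (x t) - f t (xstar t)‖ ≤ 1 := by
    obtain ⟨-, hd, hL⟩ := hX t ht
    have := hL.dist_le_mul _ hx.1 _ hstar.1
    rw [NNReal.coe_one, one_mul, dist_eq_norm] at this
    exact this.trans (hd _ hx.1 _ hstar.1)
  have h1 : coords O (effectiveDiff (f t) (x t) (xstar t)) 0 ≤ 0 := by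
    rw [coords_zero, effectiveDiff, inner_smul_left, inner_sub_left]
    exact mul_nonpos_of_nonneg_of_nonpos (by simp) (by linarith [hx.2 _ hstar.1])
  have h2 : 0 ≤ inner ℝ (effectiveDiff (f t) (x t) (xstar t)) cstar := by
    rw [effectiveDiff, inner_smul_left, inner_sub_left]
    exact mul_nonneg (by simp) (by linarith [hstar.2 _ hx.1])
  refine ⟨h1, h2, ?_, ?_⟩
  · have := real_inner_le_norm (f t (x t) - f t (xstar t)) cstar
    rw [hcs, mul_one] at this
    exact this.trans hnorm
  · have h3 := Real.le_sqrt_of_sq_le (sq_inner_le_width hO hW hmem hcs h1 h2)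
    rw [← norm_smul_effectiveDiff, real_inner_smul_left]
    exact (mul_le_of_le_one_left h2 hnorm).trans h3

/-- The periods before `t` in which the cone is updated. -/
def updatePeriods (ε : ℝ) (f : ℕ → EuclideanSpace ℝ (Fin m) → Vec n)
    (xstar x : ℕ → EuclideanSpace ℝ (Fin m)) (w : ℕ → Fin n → ℝ)
    (U : ℕ → Matrix (Fin (n + 1)) (Fin (n + 1)) ℝ) (t : ℕ) : Finset ℕ :=
  open Classical in
  {r ∈ Finset.range t | ε ^ 2 < width (w r) (U r) (effectiveDiff (f r) (x r) (xstar r))}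

lemma card_updatePeriods_succ_of_lt {t : ℕ}
    (h : ε ^ 2 < width (w t) (U t) (effectiveDiff (f t) (x t) (xstar t))) :
    (updatePeriods ε f xstar x w U (t + 1)).card = (updatePeriods ε f xstar x w U t).card + 1 := by
  rw [updatePeriods, Finset.range_add_one, Finset.filter_insert, if_pos h,
    Finset.card_insert_of_notMem (by simp)]
  rfl

lemma updatePeriods_succ_of_le {t : ℕ}
    (h : width (w t) (U t) (effectiveDiff (f t) (x t) (xstar t)) ≤ ε ^ 2) :
    updatePeriods ε f xstar x w U (t + 1) = updatePeriods ε f xstar x w U t := by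
  rw [updatePeriods, Finset.range_add_one, Finset.filter_insert, if_neg (not_lt.2 h)]
  rfl

lemma regret_le_card_add (hX : Admissible T X f) (hcs : ‖cstar‖ = 1) (hε : 0 ≤ ε)
    (hstar : ∀ t < T, xstar t ∈ argmins cstar (X t) (f t)) (hrun : IsRun ε C₀ T X f xstar x c w U)
    (hinv : ∀ t < T, U t ∈ Matrix.orthogonalGroup (Fin (n + 1)) ℝ ∧ (∀ i, 0 ≤ w t i) ∧
      cstar ∈ ellipsoidalCone (w t) (U t)) :
    regret T cstar f x xstar ≤ (updatePeriods ε f xstar x w U T).card + T * ε := by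
  classical
  have hstep : ∀ t ∈ Finset.range T, inner ℝ (f t (x t) - f t (xstar t)) cstar ≤
      (if ε ^ 2 < width (w t) (U t) (effectiveDiff (f t) (x t) (xstar t)) then 1 else 0) + ε := by
    intro t ht
    have htT := Finset.mem_range.1 ht
    obtain ⟨hU, hw, hmem⟩ := hinv t htT
    have hact := hrun.action t htT
    rw [(isCircumcenter_ellipsoidalCone hU hw (c t)).1 (hrun.proxy t htT)] at hact
    obtain ⟨-, -, h1, h2⟩ := period_bounds hX htT hcs hU hw hmem (hstar t htT) hact
    split_ifs with h
    · linarith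
    · rw [zero_add]
      exact h2.trans (Real.sqrt_le_iff.2 ⟨hε, not_lt.1 h⟩)
  refine (Finset.sum_le_sum hstep).trans (le_of_eq ?_)
  rw [Finset.sum_add_distrib, Finset.sum_boole]
  simp [updatePeriods]

/-- The invariants of a run: the cone contains `c⋆`, its squared widths are bounded below, and their
product decreases by a constant factor with every update. -/
lemma run_invariants (hX : Admissible T X f) (hC : C₀ ⊆ Metric.sphere 0 1)
    (hα : uncertaintyAngle C₀ < Real.pi / 2) (hcs : cstar ∈ C₀)
    (hstar : ∀ t < T, xstar t ∈ argmins cstar (X t) (f t)) (hrun : IsRun ε C₀ T X f xstar x c w U)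
    (hn : n ≠ 0) {μ : ℝ} (hμ : 0 < μ) (hμε : 4 * (n : ℝ) ^ 2 * μ ≤ ε ^ 2)
    (hμα : μ ≤ Real.tan (uncertaintyAngle C₀) ^ 2) :
    ∀ t ≤ T, U t ∈ Matrix.orthogonalGroup (Fin (n + 1)) ℝ ∧ (∀ i, μ ≤ w t i) ∧
      cstar ∈ ellipsoidalCone (w t) (U t) ∧
      ∏ i, w t i ≤ Real.exp (-((updatePeriods ε f xstar x w U t).card / (n : ℝ))) *
        (Real.tan (uncertaintyAngle C₀) ^ 2) ^ n := by
  intro t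
  induction t with
  | zero =>
    intro _
    refine ⟨hrun.start_orthogonal, fun i => by rwa [hrun.start_width i], ?_, ?_⟩
    · exact mem_initial_cone hrun.start_orthogonal hC hα hrun.start_axis hrun.start_width hcs
    · simp [updatePeriods, hrun.start_width]
  | succ t ih =>
    intro htT
    obtain ⟨hU, hw, hmem, hprod⟩ := ih (by omega)
    have htT' : t < T := by omega
    set δ := effectiveDiff (f t) (x t) (xstar t) with hδ
    rcases le_or_gt (width (w t) (U t) δ) (ε ^ 2) with h | h
    · obtain ⟨h1, h2⟩ := hrun.no_update t htT' h
      rw [updatePeriods_succ_of_le h, h1, h2]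
      exact ⟨hU, hw, hmem, hprod⟩
    · have hupd := hrun.cone_update t htT' h
      have hpos : 0 < width (w t) (U t) δ := (sq_nonneg ε).trans_lt h
      have hw0 : ∀ i, 0 < w t i := fun i => hμ.trans_le (hw i)
      have hact := hrun.action t htT'
      rw [(isCircumcenter_ellipsoidalCone hU (fun i => (hw0 i).le) (c t)).1
        (hrun.proxy t htT')] at hact
      obtain ⟨h1, h2, -, -⟩ := period_bounds hX htT' (by simpa using hC hcs) hU
        (fun i => (hw0 i).le) hmem (hstar t htT') hact
      -- The update condition `q > ε² ≥ 4 n² μ` is what preserves the lower bound on the widths.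
      have hw' := hupd.le hU (effectiveDiff_norm_le _ _ _) hn hμ.le hw hpos (hμε.trans h.le)
      refine ⟨hupd.orthogonal hU, hw',
        hupd.mem hU hn hw0 (fun i => hμ.trans_le (hw' i)) hpos hmem h1 h2, ?_⟩
      refine (hupd.prod_le hn hw0 hpos).trans ?_
      rw [card_updatePeriods_succ_of_lt h, Nat.cast_add, Nat.cast_one, add_div, neg_add,
        Real.exp_add]
      exact (mul_le_mul_of_nonneg_left hprod (Real.exp_pos _).le).trans_eq (by ring)

lemma tan_uncertaintyAngle_nonneg (hα : uncertaintyAngle C₀ < Real.pi / 2) :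
    0 ≤ Real.tan (uncertaintyAngle C₀) :=
  Real.tan_nonneg_of_nonneg_of_le_pi_div_two (uncertaintyAngle_nonneg C₀) hα.le

/-- If the initial widths do not exceed `ε²`, the cone is never updated. -/
lemma run_constant (hα : uncertaintyAngle C₀ < Real.pi / 2)
    (hrun : IsRun ε C₀ T X f xstar x c w U)
    (hαε : n = 0 ∨ Real.tan (uncertaintyAngle C₀) ^ 2 ≤ ε ^ 2) :
    ∀ t ≤ T, w t = w 0 ∧ U t = U 0 ∧ updatePeriods ε f xstar x w U t = ∅ := by
  intro t
  induction t with
  | zero => intro _; simp [updatePeriods]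
  | succ t ih =>
    intro htT
    obtain ⟨h1, h2, h3⟩ := ih (by omega)
    have h : width (w t) (U t) (effectiveDiff (f t) (x t) (xstar t)) ≤ ε ^ 2 := by
      rw [h1, h2]
      refine width_le hrun.start_orthogonal (effectiveDiff_norm_le _ _ _) (sq_nonneg ε) fun i => ?_
      rw [hrun.start_width]
      rcases hαε with rfl | h
      · exact i.elim0
      · exact h
    obtain ⟨h4, h5⟩ := hrun.no_update t (by omega) h
    rw [updatePeriods_succ_of_le h, h4, h5]
    exact ⟨h1, h2, h3⟩

/-- The regret is at most the number of updates plus `T ε = d`. The number of updates follows from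
squeezing `∏ w_i` between its uniform lower bound and its geometric decay. -/
theorem regret_le_of_isRun (hT : 1 ≤ T) (hC : C₀ ⊆ Metric.sphere 0 1)
    (hα : uncertaintyAngle C₀ < Real.pi / 2) (hcs : cstar ∈ C₀) (hX : Admissible T X f)
    (hstar : ∀ t < T, xstar t ∈ argmins cstar (X t) (f t))
    (hrun : IsRun (((n + 1 : ℕ) : ℝ) / (T : ℝ)) C₀ T X f xstar x c w U) :
    regret T cstar f x xstar ≤ 2 * (n : ℝ) ^ 2 *
      max 0 (Real.log (10 * (T : ℝ) * Real.tan (uncertaintyAngle C₀))) + ((n + 1 : ℕ) : ℝ) := by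
  set ε := ((n + 1 : ℕ) : ℝ) / (T : ℝ) with hε
  set τ := Real.tan (uncertaintyAngle C₀) with hτ
  have hτ0 : 0 ≤ τ := tan_uncertaintyAngle_nonneg hα
  have hT0 : (0 : ℝ) < T := by exact_mod_cast hT
  have hTε : (T : ℝ) * ε = ((n + 1 : ℕ) : ℝ) := by rw [hε]; field_simp
  have hcn : ‖cstar‖ = 1 := by simpa using hC hcs
  have hε0 : 0 ≤ ε := by positivity
  -- The first case has no updates and includes `α(C₀) = 0`, where the widths vanish and logarithms
  -- of the potential are unavailable.
  by_cases hcase : n = 0 ∨ τ ^ 2 ≤ ε ^ 2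
  · have hconst := run_constant hα hrun hcase
    have hreg := regret_le_card_add hX hcn hε0 hstar hrun fun t ht => by
      obtain ⟨h1, h2, -⟩ := hconst t ht.le
      rw [h1, h2]
      exact ⟨hrun.start_orthogonal, fun i => by rw [hrun.start_width]; positivity,
        mem_initial_cone hrun.start_orthogonal hC hα hrun.start_axis hrun.start_width hcs⟩
    rw [(hconst T le_rfl).2.2, hTε] at hreg
    refine hreg.trans ?_
    rw [Finset.card_empty, Nat.cast_zero, zero_add]
    have : 0 ≤ 2 * (n : ℝ) ^ 2 * max 0 (Real.log (10 * (T : ℝ) * τ)) := by positivity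
    linarith
  · push Not at hcase
    obtain ⟨hn, hτε⟩ := hcase
    have hn1 : (1 : ℝ) ≤ n := by exact_mod_cast Nat.one_le_iff_ne_zero.2 hn
    -- The `10` in the logarithm comes from here. The requirement `4 n² μ ≤ (n+1)²/T²` is met with
    -- room to spare, and it gives `μ ≤ ε² < τ²` as well.
    set μ : ℝ := 1 / (10 * T) ^ 2 with hμ
    have hε2 : ε ^ 2 = ((n : ℝ) + 1) ^ 2 / T ^ 2 := by rw [hε, div_pow]; push_cast; rfl
    have hμ0 : 0 < μ := by positivity
    have hμε : 4 * (n : ℝ) ^ 2 * μ ≤ ε ^ 2 := by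
      rw [hε2, hμ, ← mul_div_assoc, div_le_div_iff₀ (by positivity) (by positivity)]
      have : 4 * (n : ℝ) ^ 2 ≤ 100 * ((n : ℝ) + 1) ^ 2 := by nlinarith
      nlinarith [mul_le_mul_of_nonneg_right this (sq_nonneg (T : ℝ))]
    have hμτ : μ ≤ τ ^ 2 := by
      have : 1 ≤ 4 * (n : ℝ) ^ 2 := by nlinarith
      linarith [le_mul_of_one_le_left hμ0.le this]
    have hτpos : 0 < τ := lt_of_le_of_ne hτ0 fun h => by
      rw [← h] at hμτ; simp at hμτ; linarith
    have hinv := run_invariants hX hC hα hcs hstar hrun hn hμ0 hμε hμτ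
    have hreg := regret_le_card_add hX hcn hε0 hstar hrun fun t ht =>
      ⟨(hinv t ht.le).1, fun i => hμ0.le.trans ((hinv t ht.le).2.1 i), (hinv t ht.le).2.2.1⟩
    rw [hTε] at hreg
    obtain ⟨-, hwT, -, hprod⟩ := hinv T le_rfl
    set I := ((updatePeriods ε f xstar x w U T).card : ℝ) with hI
    have hprod' : μ ^ n ≤ ∏ i, w T i := by
      calc μ ^ n = ∏ _i : Fin n, μ := by simp
        _ ≤ ∏ i, w T i := Finset.prod_le_prod (fun _ _ => hμ0.le) fun i _ => hwT i
    have h1 := Real.log_le_log (by positivity) (hprod'.trans hprod)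
    rw [Real.log_mul (Real.exp_pos _).ne' (by positivity), Real.log_exp, Real.log_pow,
      Real.log_pow, Real.log_pow, hμ, one_div, Real.log_inv, Real.log_pow] at h1
    have h2 : Real.log (10 * (T : ℝ) * τ) = Real.log (10 * T) + Real.log τ :=
      Real.log_mul (by positivity) hτpos.ne'
    have h3 : I / n ≤ 2 * n * Real.log (10 * (T : ℝ) * τ) := by
      rw [h2]
      push_cast at h1
      linarith
    have h4 : I ≤ 2 * (n : ℝ) ^ 2 * Real.log (10 * (T : ℝ) * τ) := by
      rw [div_le_iff₀ (by linarith)] at h3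
      linarith
    have h5 : 2 * (n : ℝ) ^ 2 * Real.log (10 * (T : ℝ) * τ) ≤
        2 * (n : ℝ) ^ 2 * max 0 (Real.log (10 * (T : ℝ) * τ)) := by
      gcongr
      exact le_max_right _ _
    linarith

end Regret

/-! ### Polynomial bounds on the number of steps -/

section Cost

open MvPolynomial

/-- All bounds of sums are at most the value of the index variable `0`, which is not rebound. -/
def RExpr.Tame : RExpr → Prop
  | .get _ _ _ => True
  | .cast _ => True
  | .plus p q => p.Tame ∧ q.Tame
  | .minus p q => p.Tame ∧ q.Tame
  | .times p q => p.Tame ∧ q.Tame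
  | .over p q => p.Tame ∧ q.Tame
  | .root p => p.Tame
  | .sum v k e => v ≠ 0 ∧ (∀ ix, k.eval ix ≤ ix 0) ∧ e.Tame
  | .cond p q r s => p.Tame ∧ q.Tame ∧ r.Tame ∧ s.Tame

/-- A polynomial bound, in the value of the index variable `0`, on the number of steps. -/
def RExpr.cost : RExpr → MvPolynomial (Fin 2) ℕ
  | .get _ i j => C (i.steps + j.steps + 1)
  | .cast i => C (i.steps + 1)
  | .plus p q => p.cost + q.cost + 1
  | .minus p q => p.cost + q.cost + 1
  | .times p q => p.cost + q.cost + 1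
  | .over p q => p.cost + q.cost + 1
  | .root p => p.cost + 1
  | .sum _ k e => C (k.steps + 1) + X 0 * (e.cost + 2)
  -- Polynomials have no maximum, so both branches are charged.
  | .cond p q r s => p.cost + q.cost + 1 + (r.cost + s.cost)

lemma RExpr.steps_le_cost (mem : ℕ → ℕ → ℕ → ℝ) (D T : ℕ) (e : RExpr) : ∀ ix : ℕ → ℕ, e.Tame →
    ix 0 = D → e.steps mem ix ≤ MvPolynomial.eval ![D, T] e.cost := by
  induction e with
  | get a i j => intro ix _ _; simp [RExpr.steps, RExpr.cost]
  | cast i => intro ix _ _; simp [RExpr.steps, RExpr.cost]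
  | root p hp =>
    intro ix h h0
    have h1 := hp ix h h0
    simp only [RExpr.steps, RExpr.cost, map_add, map_one]
    omega
  | sum v k e he =>
    intro ix h h0
    simp only [RExpr.steps, RExpr.cost, map_add, map_mul, eval_C, eval_X, map_ofNat,
      Matrix.cons_val_zero]
    gcongr
    calc ∑ r ∈ Finset.range (k.eval ix), (e.steps mem (Function.update ix v r) + 2)
        ≤ ∑ _r ∈ Finset.range (k.eval ix), (MvPolynomial.eval ![D, T] e.cost + 2) := by
          refine Finset.sum_le_sum fun r _ => Nat.add_le_add_right (he _ h.2.2 ?_) 2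
          rw [Function.update_of_ne h.1.symm, h0]
      _ = k.eval ix * (MvPolynomial.eval ![D, T] e.cost + 2) := by simp
      _ ≤ D * (MvPolynomial.eval ![D, T] e.cost + 2) := by
          gcongr
          exact h0 ▸ h.2.1 ix
  | cond p q r s hp hq hr hs =>
    intro ix h h0
    have h1 := hp ix h.1 h0
    have h2 := hq ix h.2.1 h0
    have h3 := hr ix h.2.2.1 h0
    have h4 := hs ix h.2.2.2 h0
    simp only [RExpr.steps, RExpr.cost, map_add, map_one]
    split_ifs <;> omega
  | _ p q hp hq =>
    intro ix h h0
    have h1 := hp ix h.1 h0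
    have h2 := hq ix h.2 h0
    simp only [RExpr.steps, RExpr.cost, map_add, map_one]
    omega

/-- Commands without loops, in which all block sizes and all bounds of sums are at most the value of
the index variable `0`. -/
def Cmd.Tame : Cmd → Prop
  | .skip => True
  | .fill _ u v k l e => u ≠ 0 ∧ v ≠ 0 ∧ (∀ ix, k.eval ix ≤ ix 0) ∧
      (∀ ix, 0 < ix 0 → l.eval ix ≤ ix 0) ∧ e.Tame
  | .seq p q => p.Tame ∧ q.Tame
  | .cond p q r s => p.Tame ∧ q.Tame ∧ r.Tame ∧ s.Tame
  | .loop _ _ _ => False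
  | .eig _ k _ _ => ∀ ix, k.eval ix ≤ ix 0

/-- A polynomial bound, in the value of the index variable `0`, on the number of steps. -/
def Cmd.cost (κ : ℕ) : Cmd → MvPolynomial (Fin 2) ℕ
  | .skip => 0
  | .fill _ _ _ k l e => C (k.steps + l.steps + 1) + X 0 * (1 + X 0 * (e.cost + 2))
  | .seq p q => p.cost κ + q.cost κ
  | .cond p q r s => p.cost + q.cost + 1 + (r.cost κ + s.cost κ)
  | .loop _ _ _ => 0
  | .eig _ k _ _ => C (k.steps) + C κ * X 0 ^ 3 + 1

lemma Cmd.exec_ix (S : Solver) (κ : ℕ) (p : Cmd) : ∀ s : State, p.Tame →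
    (p.exec S κ s).ix = s.ix := by
  induction p with
  | skip | fill | eig => intro s _; rfl
  | seq p q hp hq => intro s h; rw [Cmd.exec, hq _ h.2, hp _ h.1]
  | cond p q r t hr ht =>
    intro s h
    rw [Cmd.exec]
    split_ifs
    · rw [hr _ h.2.2.1]
    · rw [ht _ h.2.2.2]
  | loop => intro s h; exact h.elim

lemma Cmd.exec_steps_le (S : Solver) (κ : ℕ) {D : ℕ} (hD : 0 < D) (T : ℕ) (p : Cmd) :
    ∀ s : State, p.Tame → s.ix 0 = D →
      (p.exec S κ s).steps ≤ s.steps + eval ![D, T] (p.cost κ) := by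
  induction p with
  | skip => intro s _ _; exact Nat.le_add_right _ _
  | fill a u v k l e =>
    intro s h h0
    obtain ⟨hu, hv, hk, hl, he⟩ := h
    simp only [Cmd.exec, Cmd.cost, map_add, map_mul, eval_C, eval_X, map_ofNat, map_one,
      Matrix.cons_val_zero]
    have hin : ∀ i, ∑ j ∈ Finset.range (l.eval s.ix),
        (e.steps s.mem (Function.update (Function.update s.ix u i) v j) + 2) ≤
          D * (eval ![D, T] e.cost + 2) := by
      intro i
      calc _ ≤ ∑ _j ∈ Finset.range (l.eval s.ix), (eval ![D, T] e.cost + 2) := by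
            refine Finset.sum_le_sum fun j _ =>
              Nat.add_le_add_right (RExpr.steps_le_cost _ D T e _ he ?_) 2
            rw [Function.update_of_ne hv.symm, Function.update_of_ne hu.symm, h0]
        _ = l.eval s.ix * (eval ![D, T] e.cost + 2) := by simp
        _ ≤ D * (eval ![D, T] e.cost + 2) := by
            gcongr
            -- Positivity of `D` is needed because the column count may be the constant `1`.
            exact h0 ▸ hl s.ix (h0 ▸ hD)
    have hout : ∑ i ∈ Finset.range (k.eval s.ix), (1 + ∑ j ∈ Finset.range (l.eval s.ix),
        (e.steps s.mem (Function.update (Function.update s.ix u i) v j) + 2)) ≤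
          D * (1 + D * (eval ![D, T] e.cost + 2)) := by
      calc _ ≤ ∑ _i ∈ Finset.range (k.eval s.ix), (1 + D * (eval ![D, T] e.cost + 2)) :=
            Finset.sum_le_sum fun i _ => Nat.add_le_add_left (hin i) 1
        _ = k.eval s.ix * (1 + D * (eval ![D, T] e.cost + 2)) := by simp
        _ ≤ D * (1 + D * (eval ![D, T] e.cost + 2)) := by
            gcongr
            exact h0 ▸ hk s.ix
    omega
  | seq p q hp hq =>
    intro s h h0
    have h1 := hp s h.1 h0
    have h2 := hq (p.exec S κ s) h.2 (by rw [Cmd.exec_ix S κ p s h.1, h0])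
    simp only [Cmd.exec, Cmd.cost, map_add]
    omega
  | cond p q r t hr ht =>
    intro s h h0
    have h1 := RExpr.steps_le_cost s.mem D T p s.ix h.1 h0
    have h2 := RExpr.steps_le_cost s.mem D T q s.ix h.2.1 h0
    simp only [Cmd.exec, Cmd.cost, map_add, map_one]
    split_ifs
    · refine le_trans (hr _ h.2.2.1 ?_) ?_
      · exact h0
      simp only
      omega
    · refine le_trans (ht _ h.2.2.2 ?_) ?_
      · exact h0
      simp only
      omega
  | loop => intro s h; exact h.elim
  | eig a k l q =>
    intro s h h0
    have : κ * k.eval s.ix ^ 3 ≤ κ * D ^ 3 := by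
      gcongr
      exact h0 ▸ h s.ix
    simp only [Cmd.exec, Cmd.cost, map_add, map_mul, map_pow, eval_C, eval_X, map_one,
      Matrix.cons_val_zero]
    omega

/-- A polynomial bound on the number of steps of an online program. -/
def OnlineProgram.cost (κ : ℕ) (p : OnlineProgram) : MvPolynomial (Fin 2) ℕ :=
  p.start.cost κ + X 1 * (3 * X 0 + 1 + p.step.cost κ)

lemma OnlineProgram.run_ix (p : OnlineProgram) (hs : p.start.Tame) (hp : p.step.Tame) (S : Solver)
    (κ : ℕ) {n : ℕ} (T : ℕ) (c₀ : Vec n) (τ : ℝ) (g h : ℕ → Vec n) (t : ℕ) :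
    (p.run S κ T c₀ τ g h t).ix = (inputState n T c₀ τ).ix := by
  induction t with
  | zero => exact Cmd.exec_ix S κ _ _ hs
  | succ t ih => rw [OnlineProgram.run, Cmd.exec_ix S κ _ _ hp, ← ih]; rfl

lemma OnlineProgram.run_steps_le (p : OnlineProgram) (hs : p.start.Tame) (hp : p.step.Tame)
    (S : Solver) (κ : ℕ) {n : ℕ} (T : ℕ) (c₀ : Vec n) (τ : ℝ) (g h : ℕ → Vec n) :
    (p.run S κ T c₀ τ g h T).steps ≤ eval ![n + 1, T] (p.cost κ) := by
  have key : ∀ t, (p.run S κ T c₀ τ g h t).steps ≤ eval ![n + 1, T] (p.start.cost κ) +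
      t * (3 * (n + 1) + 1 + eval ![n + 1, T] (p.step.cost κ)) := by
    intro t
    induction t with
    | zero =>
      have := Cmd.exec_steps_le S κ (D := n + 1) (Nat.succ_pos n) T p.start
        (inputState n T c₀ τ) hs rfl
      simpa [OnlineProgram.run, inputState] using this
    | succ t ih =>
      rw [OnlineProgram.run]
      refine (Cmd.exec_steps_le S κ (D := n + 1) (Nat.succ_pos n) T p.step _ hp ?_).trans ?_
      · exact congrFun (p.run_ix hs hp S κ T c₀ τ g h t) 0
      · have e : ((p.run S κ T c₀ τ g h t).receive (g t) (h t)).steps =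
          (p.run S κ T c₀ τ g h t).steps + 3 * (n + 1) + 1 := rfl
        rw [e, Nat.succ_mul t]
        omega
  simpa [OnlineProgram.cost] using key T

end Cost

/-! ### Memory after commands -/

section Memory

variable {S : Solver} {κ : ℕ} {s : State}

lemma setBlock_same {mem : ℕ → ℕ → ℕ → ℝ} {a k l i j : ℕ} {g : ℕ → ℕ → ℝ} (hi : i < k)
    (hj : j < l) : setBlock mem a k l g a i j = g i j := by
  simp [setBlock, hi, hj]

lemma setBlock_of_col {mem : ℕ → ℕ → ℕ → ℝ} {a k l i j : ℕ} {g : ℕ → ℕ → ℝ} (hj : l ≤ j) :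
    setBlock mem a k l g a i j = mem a i j := by
  simp [setBlock, hj]

lemma setBlock_of_ne {mem : ℕ → ℕ → ℕ → ℝ} {a a' k l : ℕ} {g : ℕ → ℕ → ℝ} (h : a' ≠ a) :
    setBlock mem a k l g a' = mem a' := by
  simp [setBlock, h]

lemma exec_seq (p q : Cmd) : (Cmd.seq p q).exec S κ s = q.exec S κ (p.exec S κ s) := rfl

lemma exec_fill_apply {a u v K L : ℕ} {k l : IExpr} {e : RExpr} {i j : ℕ}
    (hk : k.eval s.ix = K) (hl : l.eval s.ix = L) (hi : i < K) (hj : j < L) :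
    ((Cmd.fill a u v k l e).exec S κ s).mem a i j =
      e.eval s.mem (Function.update (Function.update s.ix u i) v j) :=
  setBlock_same (hk ▸ hi) (hl ▸ hj)

lemma exec_fill_of_col {a u v : ℕ} {k l : IExpr} {e : RExpr} {i j : ℕ} (hj : l.eval s.ix ≤ j) :
    ((Cmd.fill a u v k l e).exec S κ s).mem a i j = s.mem a i j :=
  setBlock_of_col hj

lemma exec_fill_of_ne {a a' u v : ℕ} {k l : IExpr} {e : RExpr} (h : a' ≠ a) :
    ((Cmd.fill a u v k l e).exec S κ s).mem a' = s.mem a' :=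
  setBlock_of_ne h

/-- The `k × k` block of array `a`. -/
def State.block (s : State) (a k : ℕ) : Matrix (Fin k) (Fin k) ℝ :=
  Matrix.of fun i j => s.mem a i j

lemma exec_eig_eigenvalue {a l q N : ℕ} {k : IExpr} (hk : k.eval s.ix = N) (h : l ≠ q)
    (i : Fin N) : ((Cmd.eig a k l q).exec S κ s).mem l i 0 = (S N (s.block a N)).1 i := by
  subst hk
  rw [Cmd.exec]
  simp only
  rw [setBlock_of_ne h, setBlock_same i.2 one_pos, dif_pos i.2]
  rfl

lemma exec_eig_eigenvector {a l q N : ℕ} {k : IExpr} (hk : k.eval s.ix = N) (i j : Fin N) :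
    ((Cmd.eig a k l q).exec S κ s).mem q i j = (S N (s.block a N)).2 i j := by
  subst hk
  rw [Cmd.exec]
  simp only
  rw [setBlock_same i.2 j.2, dif_pos ⟨i.2, j.2⟩]
  rfl

lemma exec_eig_of_ne {a a' l q : ℕ} {k : IExpr} (h : a' ≠ l) (h' : a' ≠ q) :
    ((Cmd.eig a k l q).exec S κ s).mem a' = s.mem a' := by
  rw [Cmd.exec]
  simp only
  rw [setBlock_of_ne h', setBlock_of_ne h]

end Memory

/-! ### The program

Array `2` holds the frame `U`, array `5` the squared widths `w`, array `6` the coordinates `δ̄`,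
array `7` the vector `b`, arrays `8` and `9` the matrices `N` and `M`, and arrays `10`, `11` and
`12`, `13` their spectral decompositions. -/

namespace Program

/-- The dimension `d`. -/
def dim : IExpr := .var 0

/-- The number `d - 1`. -/
def codim : IExpr := .minus (.var 0) (.lit 1)

/-- Entry `i` of the vector stored in column `0` of array `a`. -/
def entry (a : ℕ) (i : IExpr) : RExpr := .get a i (.lit 0)

/-- A natural number as a real constant. -/
def const (k : ℕ) : RExpr := .cast (.lit k)

/-- `w := (tan α(C₀))²`, and `U :=` an orthogonal matrix with first column `c₀`. -/
def start : Cmd :=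
  .seq (.fill 9 2 3 dim dim (.times (entry 0 (.var 2)) (entry 0 (.var 3)))) <|
  .seq (.eig 9 dim 12 2) <|
  .seq (.fill 2 2 3 dim (.lit 1) (entry 0 (.var 2))) <|
  .fill 5 2 3 codim (.lit 1) (.times (entry 1 (.lit 0)) (entry 1 (.lit 0)))

/-- Entry `i` of `f(x) - f(x⋆)`. -/
def diff (i : IExpr) : RExpr := .minus (entry 3 i) (entry 4 i)

/-- Entry `2` of `δ̄`. -/
def coordsExpr : RExpr :=
  .sum 4 dim (.times (.get 2 (.var 4) (.var 2))
    (.over (diff (.var 4)) (.root (.sum 5 dim (.times (diff (.var 5)) (diff (.var 5)))))))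

/-- The coordinate of `δ̄` that belongs to the width with the index `i`. -/
def tailCoord (i : IExpr) : RExpr := entry 6 (.plus i (.lit 1))

/-- The squared width. -/
def widthExpr : RExpr :=
  .sum 4 codim (.times (tailCoord (.var 4)) (.times (entry 5 (.var 4)) (tailCoord (.var 4))))

/-- The number `ε = d / T`. -/
def epsExpr : RExpr := .over (.cast dim) (.cast (.var 1))

/-- The entry of `diagonal w` in row `2` and column `3`. -/
def diagExpr : RExpr :=
  .cond (.cast (.var 2)) (.cast (.var 3))
    (.cond (.cast (.var 3)) (.cast (.var 2)) (entry 5 (.var 2)) (const 0)) (const 0)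

/-- The entry of `b`. -/
def bExpr : RExpr :=
  .times (.over (const 1) (.root widthExpr)) (.times (entry 5 (.var 2)) (tailCoord (.var 2)))

/-- The entry of `N` in row `2` and column `3`. -/
def nExpr : RExpr :=
  .cond (.cast dim) (const 2) (.times (.over (const 1) (const 4)) diagExpr)
    (.times (.over (.times (.cast codim) (.cast codim))
        (.minus (.times (.cast codim) (.cast codim)) (const 1)))
      (.minus diagExpr (.times (.over (const 2) (.cast dim))
        (.times (entry 7 (.var 2)) (entry 7 (.var 3))))))

/-- The entry of `a` that belongs to the index `v` of a row or column of `M`. -/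
def aExpr (v : ℕ) : RExpr := .over (entry 7 (.minus (.var v) (.lit 1))) (.cast dim)

/-- The entry of `M` in row `2` and column `3`. -/
def mExpr : RExpr :=
  .cond (.cast (.var 2)) (const 0)
    (.cond (.cast (.var 3)) (const 0) (const 1) (aExpr 3))
    (.cond (.cast (.var 3)) (const 0) (aExpr 2)
      (.minus (.times (aExpr 2) (aExpr 3))
        (.get 8 (.minus (.var 2) (.lit 1)) (.minus (.var 3) (.lit 1)))))

/-- The entry of `U V` in row `2` and column `3`. -/
def frameExpr : RExpr := .sum 4 dim (.times (.get 2 (.var 2) (.var 4)) (.get 13 (.var 4) (.var 3)))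

/-- The update of the cone. -/
def update : Cmd :=
  .seq (.fill 7 2 3 codim (.lit 1) bExpr) <|
  .seq (.fill 8 2 3 codim codim nExpr) <|
  .seq (.fill 9 2 3 dim dim mExpr) <|
  .seq (.eig 8 codim 10 11) <|
  .seq (.eig 9 dim 12 13) <|
  .seq (.fill 5 2 3 codim (.lit 1) (entry 10 (.minus codim (.plus (.var 2) (.lit 1))))) <|
  .fill 2 2 3 dim dim
    (.cond (.get 13 (.lit 0) (.lit 0)) (const 0) (.minus (const 0) frameExpr) frameExpr)

/-- One period. -/
def step : Cmd :=
  .seq (.fill 6 2 3 dim (.lit 1) coordsExpr) <|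
  .cond widthExpr (.times epsExpr epsExpr) .skip update

/-- The algorithm `EllipsoidalCones` with `ε = d / T`. -/
def ellipsoidalCones : OnlineProgram := ⟨start, step⟩

lemma eval_dim {ix : ℕ → ℕ} {n : ℕ} (h : ix 0 = n + 1) : dim.eval ix = n + 1 := h

lemma eval_codim {ix : ℕ → ℕ} {n : ℕ} (h : ix 0 = n + 1) : codim.eval ix = n := by
  simp [codim, IExpr.eval, h]

lemma start_tame : start.Tame := by
  simp [start, Cmd.Tame, RExpr.Tame, dim, codim, entry, IExpr.eval, Nat.one_le_iff_ne_zero,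
    Nat.pos_iff_ne_zero]

lemma step_tame : step.Tame := by
  simp [step, update, Cmd.Tame, RExpr.Tame, dim, codim, entry, IExpr.eval, coordsExpr, diff,
    widthExpr, tailCoord, epsExpr, bExpr, const, nExpr, diagExpr, mExpr, aExpr, frameExpr,
    Nat.one_le_iff_ne_zero, Nat.pos_iff_ne_zero]

end Program

/-- The frame stored in a state. -/
def State.frame (n : ℕ) (s : State) : Matrix (Fin (n + 1)) (Fin (n + 1)) ℝ := s.block 2 (n + 1)

/-- The squared widths stored in a state. -/
def State.widths (n : ℕ) (s : State) : Fin n → ℝ := fun i => s.mem 5 i 0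

lemma State.axis_frame (n : ℕ) (s : State) : axis (s.frame n) = s.proxy n := rfl

/-! ### Correctness of the start -/

/-- The matrix `c c'` has Rayleigh quotient `1` at `c`, so the top eigenvalue `(c'p)²` is at least
`1`, and by Cauchy-Schwarz at most `1`. The eigenvector equation then reads `(c'p) c = p`. In this
way a spectral decomposition completes `c₀` to an orthonormal basis. -/
lemma exists_sign_of_spectral_rankOne {n : ℕ} {c : Fin (n + 1) → ℝ} (hc : c ⬝ᵥ c = 1)
    {l : Fin (n + 1) → ℝ} {V : Matrix (Fin (n + 1)) (Fin (n + 1)) ℝ} (hl : Antitone l)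
    (h : IsSpectralDecomposition (Matrix.vecMulVec c c) l V) :
    ∃ σ : ℝ, σ ^ 2 = 1 ∧ ∀ i, c i = V i 0 * σ := by
  have hmul : ∀ v : Fin (n + 1) → ℝ, Matrix.vecMulVec c c *ᵥ v = (c ⬝ᵥ v) • c := fun v => by
    rw [Matrix.vecMulVec_mulVec]; ext i; simp [mul_comm]
  set p := V.col 0 with hp
  have h1 : 1 ≤ l 0 := by
    have e1 := h.dotProduct_mulVec c c
    have e2 := dotProduct_transpose_mulVec h.1 c c
    rw [hmul, hc, one_smul, hc] at e1
    rw [hc] at e2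
    have h4 : l 0 = l 0 * ((Vᵀ *ᵥ c) ⬝ᵥ (Vᵀ *ᵥ c)) := by rw [e2, mul_one]
    rw [e1, h4, dotProduct, Finset.mul_sum]
    exact Finset.sum_le_sum fun i _ =>
      mul_le_mul_of_nonneg_right (hl (Fin.zero_le i)) (mul_self_nonneg _)
  have h2 : (c ⬝ᵥ p) ^ 2 = l 0 := by
    have := h.form_col 0
    rw [← hp, hmul, dotProduct_smul, smul_eq_mul, dotProduct_comm p c, ← sq] at this
    exact this
  have h3 : (c ⬝ᵥ p) ^ 2 ≤ 1 := by
    have := Finset.sum_mul_sq_le_sq_mul_sq Finset.univ c p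
    have hpp : p ⬝ᵥ p = 1 := dotProduct_col_self h.1 0
    simp only [dotProduct, ← sq] at hc hpp
    rwa [hc, hpp, one_mul] at this
  have h4 : l 0 = 1 := le_antisymm (h2 ▸ h3) h1
  refine ⟨c ⬝ᵥ p, by rw [h2, h4], fun i => ?_⟩
  have h5 := congrFun (h.mulVec_col 0) i
  rw [← hp, hmul, h4, one_smul, Pi.smul_apply, smul_eq_mul] at h5
  have h6 : V i 0 = p i := rfl
  rw [h6, ← h5]
  rw [h4] at h2
  linear_combination (-c i) * h2

/-- Overwriting the top eigenvector by `c₀` only changes its sign, which is multiplication by a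
diagonal orthogonal matrix. -/
lemma orthogonal_of_col_zero_eq {n : ℕ} {V F : Matrix (Fin (n + 1)) (Fin (n + 1)) ℝ}
    (hV : V ∈ Matrix.orthogonalGroup (Fin (n + 1)) ℝ) {σ : ℝ} (hσ : σ ^ 2 = 1)
    (h0 : ∀ i, F i 0 = V i 0 * σ) (hs : ∀ i (j : Fin n), F i j.succ = V i j.succ) :
    F ∈ Matrix.orthogonalGroup (Fin (n + 1)) ℝ := by
  have hF : F = V * Matrix.diagonal (Fin.cons σ fun _ => 1) := by
    ext i j
    rw [Matrix.mul_diagonal]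
    refine Fin.cases ?_ (fun j => ?_) j
    · rw [h0]; rfl
    · rw [hs]; simp
  rw [hF]
  refine Submonoid.mul_mem _ hV ?_
  rw [Matrix.mem_orthogonalGroup_iff, Matrix.diagonal_transpose, Matrix.diagonal_mul_diagonal,
    ← Matrix.diagonal_one]
  congr 1
  ext i
  refine Fin.cases ?_ (fun j => ?_) i
  · simpa [sq] using hσ
  · simp

lemma start_spec {S : Solver} (hS : S.Correct) (κ : ℕ) {n : ℕ} (T : ℕ) {c₀ : Vec n}
    (hc : ‖c₀‖ = 1) (τ : ℝ) :
    let s := Program.start.exec S κ (inputState n T c₀ τ)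
    s.frame n ∈ Matrix.orthogonalGroup (Fin (n + 1)) ℝ ∧ s.proxy n = c₀ ∧
      ∀ i, s.widths n i = τ ^ 2 := by
  intro s
  set s0 := inputState n T c₀ τ with hs0
  have hm0 : ∀ i : Fin (n + 1), s0.mem 0 i 0 = c₀ i := fun i => by
    simp [hs0, inputState, i.is_le]
  have hm1 : s0.mem 1 0 0 = τ := by simp [hs0, inputState]
  have hi0 : s0.ix 0 = n + 1 := rfl
  have hs : s = Program.start.exec S κ s0 := rfl
  clear_value s s0
  simp only [Program.start, exec_seq] at hs
  set s1 := (Cmd.fill 9 2 3 Program.dim Program.dim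
    (.times (Program.entry 0 (.var 2)) (Program.entry 0 (.var 3)))).exec S κ s0 with hs1
  have h1ix : s1.ix 0 = n + 1 := hi0
  have h1m : ∀ i j : Fin (n + 1), s1.mem 9 i j = c₀ i * c₀ j := by
    intro i j
    rw [hs1, exec_fill_apply (Program.eval_dim hi0) (Program.eval_dim hi0) i.2 j.2]
    simp [RExpr.eval, IExpr.eval, Program.entry, hm0, Function.update]
  have h10 : s1.mem 0 = s0.mem 0 := exec_fill_of_ne (by norm_num)
  have h11 : s1.mem 1 = s0.mem 1 := exec_fill_of_ne (by norm_num)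
  clear_value s1
  set s2 := (Cmd.eig 9 Program.dim 12 2).exec S κ s1 with hs2
  have h2ix : s2.ix 0 = n + 1 := h1ix
  have h2m : ∀ i j : Fin (n + 1), s2.mem 2 i j = (S (n + 1) (s1.block 9 (n + 1))).2 i j :=
    fun i j => exec_eig_eigenvector (Program.eval_dim h1ix) i j
  have h20 : s2.mem 0 = s0.mem 0 := (exec_eig_of_ne (by norm_num) (by norm_num)).trans h10
  have h21 : s2.mem 1 = s0.mem 1 := (exec_eig_of_ne (by norm_num) (by norm_num)).trans h11
  clear_value s2
  set s3 := (Cmd.fill 2 2 3 Program.dim (.lit 1) (Program.entry 0 (.var 2))).exec S κ s2 with hs3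
  have h3ix : s3.ix 0 = n + 1 := h2ix
  have h3c : ∀ i : Fin (n + 1), s3.mem 2 i 0 = c₀ i := by
    intro i
    rw [hs3, exec_fill_apply (Program.eval_dim h2ix) rfl i.2 one_pos]
    simp [RExpr.eval, IExpr.eval, Program.entry, h20, hm0, Function.update]
  have h3s : ∀ (i : Fin (n + 1)) (j : Fin n), s3.mem 2 i (j + 1) = s2.mem 2 i (j + 1) := by
    intro i j
    rw [hs3, exec_fill_of_col (by simp [IExpr.eval])]
  have h31 : s3.mem 1 = s0.mem 1 := (exec_fill_of_ne (by norm_num)).trans h21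
  clear_value s3
  have h4 : s.mem 2 = s3.mem 2 := by rw [hs]; exact exec_fill_of_ne (by norm_num)
  have hA : s1.block 9 (n + 1) = Matrix.vecMulVec c₀ c₀ := by
    ext i j
    exact h1m i j
  obtain ⟨hl, hV⟩ := hS (n + 1) (s1.block 9 (n + 1)) (by
    rw [hA, Matrix.IsSymm, Matrix.transpose_vecMulVec])
  rw [hA] at hl hV
  have hcc : (c₀ : Fin (n + 1) → ℝ) ⬝ᵥ c₀ = 1 := by
    have := real_inner_self_eq_norm_sq c₀
    rw [EuclideanSpace.inner_eq_star_dotProduct, star_trivial, hc, one_pow] at this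
    exact this
  obtain ⟨σ, hσ, hσc⟩ := exists_sign_of_spectral_rankOne hcc hl hV
  refine ⟨orthogonal_of_col_zero_eq hV.1 hσ (fun i => ?_) fun i j => ?_, ?_, fun i => ?_⟩
  · rw [← hσc, ← h3c, ← h4]; rfl
  · have := h2m i j.succ
    rw [hA] at this
    rw [← this, Fin.val_succ, ← h3s, ← h4]; rfl
  · ext i
    rw [← h3c, ← h4]; rfl
  · rw [State.widths, hs, exec_fill_apply (Program.eval_codim h3ix) rfl i.2 one_pos]
    simp [RExpr.eval, IExpr.eval, Program.entry, h31, hm1, sq]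

/-! ### Correctness of one period -/

/-- Needed to reverse the order of the spectrum: the solver sorts downwards, the squared widths are
sorted upwards. -/
lemma IsSpectralDecomposition.reindex {ι : Type} [Fintype ι] [DecidableEq ι] {A V : Matrix ι ι ℝ}
    {l : ι → ℝ} (h : IsSpectralDecomposition A l V) (e : ι ≃ ι) :
    IsSpectralDecomposition A (l ∘ e) (V.submatrix id e) := by
  have hd : Matrix.diagonal (l ∘ e) = (Matrix.diagonal l).submatrix e e := by
    rw [Matrix.submatrix_diagonal_equiv]
  constructor
  · rw [Matrix.mem_orthogonalGroup_iff, Matrix.transpose_submatrix,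
      Matrix.submatrix_mul_equiv, self_mul_transpose_of_orthogonal h.1, Matrix.submatrix_one]
    exact Function.injective_id
  · rw [hd, Matrix.transpose_submatrix, Matrix.submatrix_mul_equiv, Matrix.submatrix_mul_equiv,
      Matrix.submatrix_id_id]
    exact h.2

lemma cutMatrix_isSymm {n : ℕ} (w b : Fin n → ℝ) : (cutMatrix w b).IsSymm := by
  rw [Matrix.IsSymm, cutMatrix]
  split_ifs
  · rw [Matrix.transpose_smul, Matrix.diagonal_transpose]
  · rw [Matrix.transpose_smul, Matrix.transpose_sub, Matrix.diagonal_transpose,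
      Matrix.transpose_smul, Matrix.transpose_vecMulVec]

lemma blockMatrix_isSymm {n : ℕ} (a : Fin n → ℝ) {N : Matrix (Fin n) (Fin n) ℝ}
    (hN : N.IsSymm) : (blockMatrix a N).IsSymm := by
  ext i j
  rw [Matrix.transpose_apply]
  refine Fin.cases ?_ (fun i => ?_) i <;> refine Fin.cases ?_ (fun j => ?_) j
  · rfl
  · rfl
  · rfl
  · show a j * a i - N j i = a i * a j - N i j
    rw [hN.apply, mul_comm]

lemma norm_eq_sqrt_sum_mul_self {n : ℕ} (v : Vec n) : ‖v‖ = Real.sqrt (∑ i, v i * v i) := by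
  rw [EuclideanSpace.norm_eq]
  congr 1
  exact Finset.sum_congr rfl fun i _ => by rw [Real.norm_eq_abs, sq_abs, sq]

lemma update_spec {S : Solver} (hS : S.Correct) (κ : ℕ) {n : ℕ} {s : State}
    (hix : s.ix 0 = n + 1) {δ : Vec n}
    (hδ : ∀ i : Fin (n + 1), s.mem 6 i 0 = coords (s.frame n) δ i)
    (hw : ∀ i, 0 ≤ s.widths n i) :
    ConeUpdate (s.widths n) (s.frame n) δ ((Program.update.exec S κ s).widths n)
      ((Program.update.exec S κ s).frame n) := by
  set w := s.widths n with hw_def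
  set U := s.frame n with hU_def
  have hw5 : ∀ i : Fin n, s.mem 5 i 0 = w i := fun i => rfl
  have hU2 : ∀ i j : Fin (n + 1), s.mem 2 i j = U i j := fun i j => rfl
  have hδs : ∀ i : Fin n, s.mem 6 (i + 1) 0 = coords U δ i.succ := fun i => hδ i.succ
  clear_value w U
  set s' := Program.update.exec S κ s with hs'
  clear_value s'
  simp only [Program.update, exec_seq] at hs'
  set s1 := (Cmd.fill 7 2 3 Program.codim (.lit 1) Program.bExpr).exec S κ s with hs1
  have h1ix : s1.ix 0 = n + 1 := hix
  have h1b : ∀ i : Fin n, s1.mem 7 i 0 = updB w U δ i := by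
    intro i
    rw [hs1, exec_fill_apply (Program.eval_codim hix) rfl i.2 one_pos]
    simp [Program.bExpr, Program.widthExpr, Program.tailCoord, Program.entry, Program.const,
      RExpr.eval, IExpr.eval, Function.update, Program.eval_codim, hix, Finset.sum_range, hw5, hδs,
      updB, Matrix.mulVec_diagonal, width, dotProduct]
  have h12 : s1.mem 2 = s.mem 2 := exec_fill_of_ne (by norm_num)
  have h15 : s1.mem 5 = s.mem 5 := exec_fill_of_ne (by norm_num)
  clear_value s1
  set s2 := (Cmd.fill 8 2 3 Program.codim Program.codim Program.nExpr).exec S κ s1 with hs2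
  have h2ix : s2.ix 0 = n + 1 := h1ix
  have h2N : ∀ i j : Fin n, s2.mem 8 i j = updN w U δ i j := by
    intro i j
    rw [hs2, exec_fill_apply (Program.eval_codim h1ix) (Program.eval_codim h1ix) i.2 j.2]
    set ix := Function.update (Function.update s1.ix 2 (i : ℕ)) 3 (j : ℕ) with hix'
    have e0 : ix 0 = n + 1 := h1ix
    have e2 : ix 2 = i := rfl
    have e3 : ix 3 = j := rfl
    have hdiag : Program.diagExpr.eval s1.mem ix = Matrix.diagonal w i j := by
      simp only [Program.diagExpr, Program.entry, Program.const, RExpr.eval, IExpr.eval, e2, e3,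
        Nat.cast_le, Nat.cast_zero, h15, hw5, Fin.val_fin_le, Matrix.diagonal_apply]
      rcases lt_trichotomy i j with h | h | h
      · rw [if_pos h.le, if_neg (not_le.2 h), if_neg h.ne]
      · rw [if_pos h.le, if_pos h.ge, if_pos h]
      · rw [if_neg (not_le.2 h), if_neg h.ne']
    -- The index `i` witnesses `n ≥ 1`, so the program's test `d ≤ 2` singles out `d = 2`.
    have hn : ((n + 1 : ℕ) : ℝ) ≤ ((2 : ℕ) : ℝ) ↔ n = 1 := by
      rw [Nat.cast_le]
      have := i.pos
      omega
    simp only [Program.nExpr, RExpr.eval, hdiag, Program.const, Program.entry, IExpr.eval,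
      Program.eval_dim e0, Program.eval_codim e0, e2, e3, h1b, hn, updN]
    split_ifs
    · simp
    · simp [sq, Matrix.vecMulVec_apply]
  have h22 : s2.mem 2 = s.mem 2 := (exec_fill_of_ne (by norm_num)).trans h12
  have h27 : s2.mem 7 = s1.mem 7 := exec_fill_of_ne (by norm_num)
  clear_value s2
  set s3 := (Cmd.fill 9 2 3 Program.dim Program.dim Program.mExpr).exec S κ s2 with hs3
  have h3ix : s3.ix 0 = n + 1 := h2ix
  have h3M : ∀ i j : Fin (n + 1), s3.mem 9 i j = updM w U δ i j := by
    intro i j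
    rw [hs3, exec_fill_apply (Program.eval_dim h2ix) (Program.eval_dim h2ix) i.2 j.2]
    set ix := Function.update (Function.update s2.ix 2 (i : ℕ)) 3 (j : ℕ) with hix'
    have e0 : ix 0 = n + 1 := h2ix
    have e2 : ix 2 = i := rfl
    have e3 : ix 3 = j := rfl
    have ha : ∀ (v : ℕ) (k : Fin n), ix v = k + 1 →
        (Program.aExpr v).eval s2.mem ix = updA w U δ k := by
      intro v k hk
      simp [Program.aExpr, Program.entry, RExpr.eval, IExpr.eval, Program.eval_dim e0, hk, h27,
        h1b, updA, div_eq_inv_mul]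
    have hpos : ∀ k : ℕ, ¬ ((k + 1 : ℕ) : ℝ) ≤ 0 := fun k => not_le.2 (by positivity)
    simp only [Program.mExpr, RExpr.eval, IExpr.eval, Program.const, e2, e3, Nat.cast_zero,
      Nat.cast_one]
    clear_value ix
    clear hix'
    induction i using Fin.cases with
    | zero =>
      induction j using Fin.cases with
      | zero => simp [updM]
      | succ j =>
        rw [Fin.val_succ] at e3
        rw [Fin.val_succ, Fin.val_zero, Nat.cast_zero, if_pos le_rfl, if_neg (hpos _), ha 3 j e3]
        rfl
    | succ i =>
      rw [Fin.val_succ] at e2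
      induction j using Fin.cases with
      | zero =>
        rw [Fin.val_succ, Fin.val_zero, Nat.cast_zero, if_neg (hpos _), if_pos le_rfl, ha 2 i e2]
        rfl
      | succ j =>
        rw [Fin.val_succ] at e3
        rw [Fin.val_succ, Fin.val_succ, if_neg (hpos _), if_neg (hpos _), ha 2 i e2, ha 3 j e3,
          Nat.add_sub_cancel, Nat.add_sub_cancel, h2N]
        rfl
  have h32 : s3.mem 2 = s.mem 2 := (exec_fill_of_ne (by norm_num)).trans h22
  have h38 : s3.mem 8 = s2.mem 8 := exec_fill_of_ne (by norm_num)
  clear_value s3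
  have hNs : s3.block 8 n = updN w U δ := by
    ext i j
    rw [← h2N, ← h38]; rfl
  have hMs : s3.block 9 (n + 1) = updM w U δ := by
    ext i j
    rw [← h3M]; rfl
  set s4 := (Cmd.eig 8 Program.codim 10 11).exec S κ s3 with hs4
  have h4ix : s4.ix 0 = n + 1 := h3ix
  have h4l : ∀ i : Fin n, s4.mem 10 i 0 = (S n (updN w U δ)).1 i := fun i =>
    hNs ▸ exec_eig_eigenvalue (Program.eval_codim h3ix) (by norm_num) i
  have h42 : s4.mem 2 = s.mem 2 := (exec_eig_of_ne (by norm_num) (by norm_num)).trans h32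
  have h49 : s4.mem 9 = s3.mem 9 := exec_eig_of_ne (by norm_num) (by norm_num)
  have h4M : s4.block 9 (n + 1) = updM w U δ := by
    rw [← hMs, State.block, State.block, h49]
  clear_value s4
  set s5 := (Cmd.eig 9 Program.dim 12 13).exec S κ s4 with hs5
  have h5ix : s5.ix 0 = n + 1 := h4ix
  have h5V : ∀ i j : Fin (n + 1), s5.mem 13 i j = (S (n + 1) (updM w U δ)).2 i j := fun i j =>
    h4M ▸ exec_eig_eigenvector (Program.eval_dim h4ix) i j
  have h5l : s5.mem 10 = s4.mem 10 := exec_eig_of_ne (by norm_num) (by norm_num)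
  have h52 : s5.mem 2 = s.mem 2 := (exec_eig_of_ne (by norm_num) (by norm_num)).trans h42
  clear_value s5
  set s6 := (Cmd.fill 5 2 3 Program.codim (.lit 1) (Program.entry 10
    (.minus Program.codim (.plus (.var 2) (.lit 1))))).exec S κ s5 with hs6
  have h6ix : s6.ix 0 = n + 1 := h5ix
  have h6w : ∀ i : Fin n, s6.mem 5 i 0 = (S n (updN w U δ)).1 (Fin.rev i) := by
    intro i
    rw [hs6, exec_fill_apply (Program.eval_codim h5ix) rfl i.2 one_pos, ← h4l, ← h5l, Fin.val_rev]
    simp [Program.entry, RExpr.eval, IExpr.eval, Program.eval_codim, h5ix, Function.update]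
  have h62 : s6.mem 2 = s.mem 2 := (exec_fill_of_ne (by norm_num)).trans h52
  have h613 : s6.mem 13 = s5.mem 13 := exec_fill_of_ne (by norm_num)
  clear_value s6
  have h75 : s'.mem 5 = s6.mem 5 := by rw [hs']; exact exec_fill_of_ne (by norm_num)
  set V := (S (n + 1) (updM w U δ)).2 with hV_def
  have h7U : ∀ i j : Fin (n + 1), s'.mem 2 i j =
      if V 0 0 ≤ 0 then -(U * V) i j else (U * V) i j := by
    intro i j
    rw [hs', exec_fill_apply (Program.eval_dim h6ix) (Program.eval_dim h6ix) i.2 j.2]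
    have h00 : s6.mem 13 0 0 = V 0 0 := by rw [h613]; exact h5V 0 0
    have hUk : ∀ k : Fin (n + 1), s6.mem 2 i k = U i k := fun k => by rw [h62, hU2]
    have hVk : ∀ k : Fin (n + 1), s6.mem 13 k j = V k j := fun k => by rw [h613, h5V]
    simp [Program.frameExpr, Program.const, RExpr.eval, IExpr.eval, Program.eval_dim, h6ix,
      Function.update, h00, Finset.sum_range, hUk, hVk, Matrix.mul_apply]
  have hNsymm : (updN w U δ).IsSymm := cutMatrix_isSymm _ _
  obtain ⟨hlN, hQ⟩ := hS n (updN w U δ) hNsymm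
  obtain ⟨hlM, hV⟩ := hS (n + 1) (updM w U δ) (blockMatrix_isSymm _ hNsymm)
  refine ⟨⟨?_, (S n (updN w U δ)).2.submatrix id Fin.revPerm, ?_⟩, ?_⟩
  · intro i j hij
    show s'.mem 5 i 0 ≤ s'.mem 5 j 0
    rw [h75, h6w, h6w]
    exact hlN (Fin.rev_le_rev.2 hij)
  · have : s'.widths n = (S n (updN w U δ)).1 ∘ Fin.revPerm := by
      ext i
      show s'.mem 5 i 0 = _
      rw [h75, h6w]; rfl
    rw [this]
    exact hQ.reindex _
  -- Nonnegative widths exclude `V₁₁ = 0`; hence negating the frame exactly when `V₁₁ ≤ 0` produces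
  -- a strictly positive entry.
  · have hne : V 0 0 ≠ 0 := eigenvector_zero_ne_zero hV hlM (updN_nonneg hw δ)
    by_cases h0 : V 0 0 ≤ 0
    · refine ⟨_, -V, hlM, hV.neg, by simpa using lt_of_le_of_ne h0 hne, ?_⟩
      ext i j
      rw [Matrix.mul_neg, Matrix.neg_apply]
      exact (h7U i j).trans (if_pos h0)
    · refine ⟨_, V, hlM, hV, not_le.1 h0, ?_⟩
      ext i j
      exact (h7U i j).trans (if_neg h0)

lemma step_spec {S : Solver} (hS : S.Correct) (κ : ℕ) {n T : ℕ} {s : State}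
    (h0 : s.ix 0 = n + 1) (h1 : s.ix 1 = T) (hw : ∀ i, 0 ≤ s.widths n i) (g h : Vec n) :
    let s' := Program.step.exec S κ (s.receive g h)
    let δ := ‖g - h‖⁻¹ • (g - h)
    (width (s.widths n) (s.frame n) δ ≤ (((n + 1 : ℕ) : ℝ) / (T : ℝ)) ^ 2 →
      s'.widths n = s.widths n ∧ s'.frame n = s.frame n) ∧
    ((((n + 1 : ℕ) : ℝ) / (T : ℝ)) ^ 2 < width (s.widths n) (s.frame n) δ →
      ConeUpdate (s.widths n) (s.frame n) δ (s'.widths n) (s'.frame n)) := by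
  intro s' δ
  set r := s.receive g h with hr
  have hs' : s' = Program.step.exec S κ r := rfl
  clear_value s'
  have hr0 : r.ix 0 = n + 1 := h0
  have hr1 : r.ix 1 = T := h1
  have hr3 : ∀ i : Fin (n + 1), r.mem 3 i 0 = g i := fun i => by
    rw [hr, State.receive]
    simp only
    rw [setBlock_of_ne (by norm_num), setBlock_same i.2 one_pos, dif_pos i.2]
  have hr4 : ∀ i : Fin (n + 1), r.mem 4 i 0 = h i := fun i => by
    rw [hr, State.receive]
    simp only
    rw [setBlock_same i.2 one_pos, dif_pos i.2]
  have hr2 : r.mem 2 = s.mem 2 := by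
    rw [hr, State.receive]
    simp only
    rw [setBlock_of_ne (by norm_num), setBlock_of_ne (by norm_num)]
  have hr5 : r.mem 5 = s.mem 5 := by
    rw [hr, State.receive]
    simp only
    rw [setBlock_of_ne (by norm_num), setBlock_of_ne (by norm_num)]
  clear_value r
  simp only [Program.step, exec_seq] at hs'
  set s1 := (Cmd.fill 6 2 3 Program.dim (.lit 1) Program.coordsExpr).exec S κ r with hs1
  have h10 : s1.ix 0 = n + 1 := hr0
  have h11 : s1.ix 1 = T := hr1
  have h12 : s1.mem 2 = s.mem 2 := (exec_fill_of_ne (by norm_num)).trans hr2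
  have h15 : s1.mem 5 = s.mem 5 := (exec_fill_of_ne (by norm_num)).trans hr5
  have hframe : s1.frame n = s.frame n := by
    rw [State.frame, State.frame, State.block, State.block, h12]
  have hwidths : s1.widths n = s.widths n := by
    unfold State.widths
    rw [h15]
  have h16 : ∀ i : Fin (n + 1), s1.mem 6 i 0 = coords (s.frame n) δ i := by
    intro i
    rw [hs1, exec_fill_apply (Program.eval_dim hr0) rfl i.2 one_pos]
    have hU : ∀ k : Fin (n + 1), r.mem 2 k i = s.frame n k i := fun k => by rw [hr2]; rfl
    simp only [Program.coordsExpr, Program.diff, Program.entry, RExpr.eval, IExpr.eval,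
      Program.dim, Function.update, hr0, Finset.sum_range]
    -- If the two answers coincide, the program's division by a zero norm gives `0`, in agreement
    -- with the convention `δ = 0`.
    simp [hr3, hr4, hU, coords, δ, norm_eq_sqrt_sum_mul_self, Matrix.mulVec, dotProduct,
      div_eq_inv_mul]
  clear_value s1
  have hq : Program.widthExpr.eval s1.mem s1.ix = width (s.widths n) (s.frame n) δ := by
    have h16' : ∀ i : Fin n, s1.mem 6 (i + 1) 0 = coords (s.frame n) δ i.succ :=
      fun i => h16 i.succ
    have h15' : ∀ i : Fin n, s1.mem 5 i 0 = s.widths n i := fun i => by rw [h15]; rfl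
    simp [Program.widthExpr, Program.tailCoord, Program.entry, RExpr.eval, IExpr.eval,
      Function.update, Program.eval_codim h10, Finset.sum_range, h16', h15', width, dotProduct,
      Matrix.mulVec_diagonal]
  have hε : (Program.epsExpr.times Program.epsExpr).eval s1.mem s1.ix =
      (((n + 1 : ℕ) : ℝ) / (T : ℝ)) ^ 2 := by
    simp only [Program.epsExpr, RExpr.eval, IExpr.eval, Program.eval_dim h10, h11, sq]
  rw [Cmd.exec, hq, hε] at hs'
  set s2 : State := { mem := s1.mem, ix := s1.ix, steps := _ } with hs2
  have h20 : s2.ix 0 = n + 1 := h10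
  have hframe2 : s2.frame n = s.frame n := hframe
  have hwidths2 : s2.widths n = s.widths n := hwidths
  have h26 : ∀ i : Fin (n + 1), s2.mem 6 i 0 = coords (s.frame n) δ i := h16
  clear_value s2
  constructor
  · intro hle
    rw [if_pos hle] at hs'
    rw [hs', ← hwidths2, ← hframe2]
    exact ⟨rfl, rfl⟩
  · intro hlt
    rw [if_neg (not_le.2 hlt)] at hs'
    rw [hs', ← hwidths2, ← hframe2]
    refine update_spec hS κ h20 (fun i => ?_) fun i => ?_
    · rw [h26, hframe2]
    · rw [hwidths2]; exact hw i

/-- Orthogonality of the frame and nonnegativity of the widths are the only invariants required.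
Both survive updates for arbitrary answers, so neither the position of `c⋆` nor a lower bound on the
widths enters. -/
theorem isRun_ellipsoidalCones {S : Solver} (hS : S.Correct) (κ : ℕ) {n m T : ℕ}
    {C₀ : Set (Vec n)} {c₀ : Vec n} (hc₀ : IsCircumcenter C₀ c₀)
    {X : ℕ → Set (EuclideanSpace ℝ (Fin m))} {f : ℕ → EuclideanSpace ℝ (Fin m) → Vec n}
    {xstar x : ℕ → EuclideanSpace ℝ (Fin m)} {s : ℕ → State}
    (hs : s = Program.ellipsoidalCones.run S κ T c₀ (Real.tan (uncertaintyAngle C₀))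
      (fun t => f t (x t)) fun t => f t (xstar t))
    (hx : ∀ t < T, x t ∈ argmins ((s t).proxy n) (X t) (f t)) :
    IsRun (((n + 1 : ℕ) : ℝ) / (T : ℝ)) C₀ T X f xstar x (fun t => (s t).proxy n)
      (fun t => (s t).widths n) fun t => (s t).frame n := by
  obtain ⟨hU0, hc, hw0⟩ := start_spec hS κ T hc₀.1 (Real.tan (uncertaintyAngle C₀))
  have hs0 : s 0 = Program.start.exec S κ (inputState n T c₀ (Real.tan (uncertaintyAngle C₀))) := by
    rw [hs]; rfl
  have hss : ∀ t, s (t + 1) =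
      Program.step.exec S κ ((s t).receive (f t (x t)) (f t (xstar t))) := fun t => by
    rw [hs]; rfl
  have hix : ∀ t, (s t).ix = (inputState n T c₀ (Real.tan (uncertaintyAngle C₀))).ix := fun t => by
    rw [hs]
    exact OnlineProgram.run_ix _ Program.start_tame Program.step_tame _ _ _ _ _ _ _ _
  rw [← hs0] at hU0 hc hw0
  have hstep := fun t (hw : ∀ i, 0 ≤ (s t).widths n i) => step_spec (T := T) hS κ
    (congrFun (hix t) 0) (congrFun (hix t) 1) hw (f t (x t)) (f t (xstar t))
  simp only [← hss] at hstep
  have hinv : ∀ t, (s t).frame n ∈ Matrix.orthogonalGroup (Fin (n + 1)) ℝ ∧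
      ∀ i, 0 ≤ (s t).widths n i := by
    intro t
    induction t with
    | zero => exact ⟨hU0, fun i => by rw [hw0]; positivity⟩
    | succ t ih =>
      obtain ⟨h1, h2⟩ := hstep t ih.2
      rcases le_or_gt (width ((s t).widths n) ((s t).frame n)
        (‖f t (x t) - f t (xstar t)‖⁻¹ • (f t (x t) - f t (xstar t))))
        ((((n + 1 : ℕ) : ℝ) / (T : ℝ)) ^ 2) with h | h
      · rw [(h1 h).1, (h1 h).2]; exact ih
      · exact ⟨(h2 h).orthogonal ih.1, (h2 h).nonneg ih.2⟩
  refine ⟨hU0, ?_, hw0, fun t _ => ?_, hx, fun t _ => (hstep t (hinv t).2).2,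
    fun t _ => (hstep t (hinv t).2).1⟩
  · show IsCircumcenter C₀ ((s 0).proxy n)
    rw [hc]; exact hc₀
  · rw [isCircumcenter_ellipsoidalCone (hinv t).1 (hinv t).2]
    exact ((s t).axis_frame n).symm

end ConeRegret

end

/-! ### The regret bound and the polynomial-time program combined -/

theorem mainTheorem2 :
    -- regret of every run of the algorithm
    (∀ (n m T : ℕ) (C₀ : Set (ConeRegret.Vec n)) (cstar : ConeRegret.Vec n)
      (X : ℕ → Set (EuclideanSpace ℝ (Fin m)))
      (f : ℕ → EuclideanSpace ℝ (Fin m) → ConeRegret.Vec n)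
      (xstar x : ℕ → EuclideanSpace ℝ (Fin m)) (c : ℕ → ConeRegret.Vec n) (w : ℕ → Fin n → ℝ)
      (U : ℕ → Matrix (Fin (n + 1)) (Fin (n + 1)) ℝ),
      1 ≤ T → C₀ ⊆ Metric.sphere 0 1 → ConeRegret.uncertaintyAngle C₀ < Real.pi / 2 →
      cstar ∈ C₀ → ConeRegret.Admissible T X f →
      (∀ t < T, xstar t ∈ ConeRegret.argmins cstar (X t) (f t)) →
      ConeRegret.IsRun (((n + 1 : ℕ) : ℝ) / (T : ℝ)) C₀ T X f xstar x c w U →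
      ConeRegret.regret T cstar f x xstar ≤
        2 * (n : ℝ) ^ 2 *
          max 0 (Real.log (10 * (T : ℝ) * Real.tan (ConeRegret.uncertaintyAngle C₀)))
        + ((n + 1 : ℕ) : ℝ)) ∧
    -- one program, for all dimensions and horizons, carries out the algorithm in polynomial time
    (∃ p : ConeRegret.OnlineProgram, ∀ κ : ℕ, ∃ P : MvPolynomial (Fin 2) ℕ,
      ∀ (S : ConeRegret.Solver) (n m T : ℕ) (C₀ : Set (ConeRegret.Vec n))
      (c₀ cstar : ConeRegret.Vec n) (X : ℕ → Set (EuclideanSpace ℝ (Fin m)))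
      (f : ℕ → EuclideanSpace ℝ (Fin m) → ConeRegret.Vec n)
      (xstar x : ℕ → EuclideanSpace ℝ (Fin m)) (s : ℕ → ConeRegret.State),
      S.Correct → 1 ≤ T → C₀ ⊆ Metric.sphere 0 1 →
      ConeRegret.uncertaintyAngle C₀ < Real.pi / 2 → ConeRegret.IsCircumcenter C₀ c₀ →
      cstar ∈ C₀ → ConeRegret.Admissible T X f →
      (∀ t < T, xstar t ∈ ConeRegret.argmins cstar (X t) (f t)) →
      s = p.run S κ T c₀ (Real.tan (ConeRegret.uncertaintyAngle C₀))
        (fun t => f t (x t)) (fun t => f t (xstar t)) →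
      (∀ t < T, x t ∈ ConeRegret.argmins ((s t).proxy n) (X t) (f t)) →
      (∃ (w : ℕ → Fin n → ℝ) (U : ℕ → Matrix (Fin (n + 1)) (Fin (n + 1)) ℝ),
        ConeRegret.IsRun (((n + 1 : ℕ) : ℝ) / (T : ℝ)) C₀ T X f xstar x
          (fun t => (s t).proxy n) w U) ∧
      (s T).steps ≤ MvPolynomial.eval ![n + 1, T] P) := by
  refine ⟨?_, ConeRegret.Program.ellipsoidalCones, fun κ =>
    ⟨ConeRegret.Program.ellipsoidalCones.cost κ, ?_⟩⟩
  · intro n m T C₀ cstar X f xstar x c w U hT hC hα hcs hX hstar hrun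
    exact ConeRegret.regret_le_of_isRun hT hC hα hcs hX hstar hrun
  · intro S n m T C₀ c₀ cstar X f xstar x s hS _ _ _ hc₀ _ _ _ hs hx
    refine ⟨⟨_, _, ConeRegret.isRun_ellipsoidalCones hS κ hc₀ hs hx⟩, ?_⟩
    rw [hs]
    exact ConeRegret.OnlineProgram.run_steps_le _ ConeRegret.Program.start_tame
      ConeRegret.Program.step_tame _ _ _ _ _ _ _
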